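/- Let $\bar M=\langle M,<,+,\cdot,0,1\rangle$ be a real closed field and let $\mathcal F$ be a family of smooth functions $f:M^n\to M$, for various $n$, where continuity, partial derivatives and smoothness are taken in the usual $\varepsilon$-$\delta$ sense over $M$. Suppose that $\mathcal M=\langle\bar M,\mathcal F\rangle$ is a locally polynomially bounded structure, i.e. $\mathcal M$ is o-minimal, its theory is model complete, and the structure $\mathcal M_0=\langle \bar M,\mathcal F^{res}\rangle$ is polynomially bounded (every function $h:M\to M$ definable in $\mathcal M_0$ satisfies $|h(x)|\le x^N$ for some $N\in\mathbb N$ and all sufficiently large $x$), where $\mathcal F^{res}$ consists of the restrictions of the members of $\mathcal F$ to bounded open boxes. "Definable" means definable in $\mathcal M$ with parameters and "$0$-definable" means definable in $\mathcal M$ without parameters. A smooth definable function $f:U\to M$ on an open set $U\subseteq M^n$ has *controlled derivatives* if there are a definable continuous function $\omega:U\to M_{\ge 0}$ and $C_i\in M$, $E_i\in\mathbb N$ ($i\in\mathbb N$) such that $$|D^{\alpha}f(\bar x)|\le C_{|\alpha|}\,\omega(\bar x)^{E_{|\alpha|}}\qquad\text{for all }\alpha\in\mathbb N^n\text{ and all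 }\bar x\in U .$$ Let $\widetilde{\mathcal F}$ be the smallest collection of functions that contains $\mathcal F$ and all polynomials over $\mathbb Q$ and is closed under the $\mathbb Q$-algebra operations, under partial differentiation, and under renaming variables and adding dummy variables; let $R_n$ be the set of $n$-ary functions in $\widetilde{\mathcal F}$. A $0$-definable function $f:U\to M$ on an open set $U\subseteq M^n$ is *implicitly defined over* $\mathcal F$ if there are $m\ge 1$, functions $g_1,\dots,g_m\in R_{n+m}$ and continuous $0$-definable functions $\phi_1,\dots,\phi_m:U\to M$ such that $f=\phi_i$ for some $i$ and, for every $\bar x\in U$, the point $\bar y=(\phi_1(\bar x),\dots,\phi_m(\bar x))\in M^m$ satisfies $g_j(\bar x,\bar y)=0$ for $j=1,\dots,m$, and the gradients at $\bar y$ of the functions $g_1(\bar x,\cdot),\dots,g_m(\bar x,\cdot)$ are linearly independent over $M$. **Proposition.** Assume that every function in $\mathcal F$ has controlled derivatives. Then every function $f:U\to M$ that is implicitly defined over $\mathcal F$ has controlled derivatives (in particular, $f$ is smooth). -/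

import Mathlib

open Set Filter Topology FirstOrder

universe u

namespace ControlledDeriv

/-! ### Differential calculus over an ordered field -/

section Calculus

variable {M : Type u} [Field M] [TopologicalSpace M]

/-- `f` has partial derivative `d` at `x` in the direction of the `i`-th coordinate. For the order
topology of an ordered field this is the usual `ε`-`δ` definition. -/
def HasPDeriv {n : ℕ} (i : Fin n) (f : (Fin n → M) → M) (x : Fin n → M) (d : M) : Prop :=
  Tendsto (fun h : M => (f (Function.update x i (x i + h)) - f x) / h) (𝓝[≠] 0) (𝓝 d)

open Classical in
/-- The partial derivative `∂f/∂xᵢ` (with value `0` at the points where it does not exist). -/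
noncomputable def pderiv {n : ℕ} (i : Fin n) (f : (Fin n → M) → M) : (Fin n → M) → M :=
  fun x => if h : ∃ d, HasPDeriv i f x d then h.choose else 0

/-- `∂_{i₁} ∂_{i₂} ⋯ ∂_{iₖ} f` for a list `[i₁, …, iₖ]` of directions. -/
noncomputable def iterPDeriv {n : ℕ} : List (Fin n) → ((Fin n → M) → M) → ((Fin n → M) → M)
  | [], f => f
  | i :: l, f => pderiv i (iterPDeriv l f)

/-- `D^α f` for a multi-index `α`: differentiate `α i` times in the direction `i`, for all `i`. -/
noncomputable def multiDeriv {n : ℕ} (α : Fin n → ℕ) (f : (Fin n → M) → M) :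
    (Fin n → M) → M :=
  iterPDeriv ((List.finRange n).flatMap fun i => List.replicate (α i) i) f

/-- `f` is smooth on `U` (meant for open `U`): all iterated partial derivatives of all orders
exist and are continuous on `U`. Only the values of `f` on `U` matter when `U` is open. -/
def IsSmoothOn {n : ℕ} (U : Set (Fin n → M)) (f : (Fin n → M) → M) : Prop :=
  ∀ l : List (Fin n), ContinuousOn (iterPDeriv l f) U ∧
    ∀ x ∈ U, ∀ i, ∃ d, HasPDeriv i (iterPDeriv l f) x d

/-- The gradient of `f` at `x`. -/
noncomputable def grad {n : ℕ} (f : (Fin n → M) → M) (x : Fin n → M) : Fin n → M :=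
  fun i => pderiv i f x

/-- `V^reg_n(f₁, …, f_p)`: the common zeros at which the gradients are linearly independent. -/
def Vreg {n p : ℕ} (f : Fin p → (Fin n → M) → M) : Set (Fin n → M) :=
  {x | (∀ j, f j x = 0) ∧ LinearIndependent M fun j => grad (f j) x}

end Calculus

/-! ### The structure `⟨M̄, F⟩` -/

section Structures

variable {M : Type u}

/-- The language of ordered rings with an additional `n`-ary function symbol for each member of
`F n`, for every `n`. -/
def lang (F : ∀ n : ℕ, Set ((Fin n → M) → M)) : FirstOrder.Language.{u, 0} where
  Functions n := Language.ring.Functions n ⊕ F n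
  Relations n := Language.order.Relations n

/-- `⟨M̄, F⟩`: the expansion of the ordered field `M` by the functions in `F`. -/
instance langStructure [Field M] [LinearOrder M] (F : ∀ n : ℕ, Set ((Fin n → M) → M)) :
    (lang F).Structure M where
  funMap
    | .inl s, x => (Ring.compatibleRingOfRing M).toStructure.funMap s x
    | .inr f, x => f.1 x
  RelMap r x := (Language.orderStructure (M := M)).RelMap r x

/-- The function `f|_U` is definable in `⟨M̄, F⟩` with parameters from `A`, that is, its graph
`{(x, y) : x ∈ U, y = f x}` is. Here `f` is a total function of which only the values on `U`
are used. -/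
def DefinableOn [Field M] [LinearOrder M] (F : ∀ n : ℕ, Set ((Fin n → M) → M)) (A : Set M)
    {n : ℕ} (U : Set (Fin n → M)) (f : (Fin n → M) → M) : Prop :=
  A.Definable (lang F) {v : Fin (n + 1) → M | Fin.init v ∈ U ∧ f (Fin.init v) = v (Fin.last n)}

/-- A structure on a linear order is o-minimal if every subset of the line that is definable with
parameters is a finite union of points and open intervals with endpoints in `M ∪ {±∞}`. -/
def IsOMinimal (L : FirstOrder.Language.{u, 0}) (M : Type u) [LinearOrder M] [L.Structure M] : Prop :=
  ∀ s : Set M, (univ : Set M).Definable₁ L s →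
    ∃ S : Set (Set M), S.Finite ∧ s = ⋃₀ S ∧
      ∀ t ∈ S, (∃ a, t = {a}) ∨ (∃ a b, t = Ioo a b) ∨ (∃ a, t = Iio a) ∨ (∃ a, t = Ioi a) ∨
        t = univ

/-- A theory is model complete: each formula is equivalent, modulo the theory, to an existential
formula. -/
def IsModelComplete {L : FirstOrder.Language.{u, 0}} (T : L.Theory) : Prop :=
  ∀ (n : ℕ) (φ : L.Formula (Fin n)), ∃ ψ : L.Formula (Fin n),
    ψ.IsExistential ∧ T.ModelsBoundedFormula (φ.iff ψ)

/-- A structure on an ordered field is polynomially bounded: each one-variable function that is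
definable with parameters is eventually bounded by a power `x ^ N`. -/
def IsPolynomiallyBounded (L : FirstOrder.Language.{u, 0}) (M : Type u) [Field M] [LinearOrder M]
    [L.Structure M] : Prop :=
  ∀ h : M → M, (univ : Set M).Definable₂ L {p : M × M | h p.1 = p.2} →
    ∃ (N : ℕ) (a : M), ∀ x, a < x → |h x| ≤ x ^ N

open Classical in
/-- `F^res`: the restrictions `f|_B` of the members `f` of `F` to bounded open boxes
`B = ∏ (aᵢ, bᵢ)`, made total, as usual, by the value `0` outside `B`. -/
def restrictedFamily [Field M] [LinearOrder M] (F : ∀ n : ℕ, Set ((Fin n → M) → M)) :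
    ∀ n : ℕ, Set ((Fin n → M) → M) :=
  fun n => {g | ∃ f ∈ F n, ∃ a b : Fin n → M,
    g = fun x => if ∀ i, a i < x i ∧ x i < b i then f x else 0}

/-- `⟨M̄, F⟩` is a locally polynomially bounded structure: `F` consists of smooth functions,
`⟨M̄, F⟩` is o-minimal with a model complete theory, and `⟨M̄, F^res⟩` is polynomially
bounded. -/
structure IsLPB [Field M] [LinearOrder M] [TopologicalSpace M]
    (F : ∀ n : ℕ, Set ((Fin n → M) → M)) : Prop where
  smooth : ∀ n, ∀ f ∈ F n, IsSmoothOn univ f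
  oMinimal : IsOMinimal (lang F) M
  modelComplete : IsModelComplete ((lang F).completeTheory M)
  polynomiallyBounded : IsPolynomiallyBounded (lang (restrictedFamily F)) M

end Structures

/-! ### Implicitly defined functions and controlled derivatives -/

section Main

variable {M : Type u} [Field M] [LinearOrder M] [IsStrictOrderedRing M] [TopologicalSpace M]

/-- Membership in `F̃`, the smallest collection of functions that contains `F` and all polynomials
over `ℚ` and is closed under the `ℚ`-algebra operations and partial differentiation, where an
`n`-ary function also counts as a `k`-ary function through any choice of `n` distinct variables
among `k`. -/
inductive MemTilde (F : ∀ n : ℕ, Set ((Fin n → M) → M)) :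
    ∀ {n : ℕ}, ((Fin n → M) → M) → Prop
  | base {n : ℕ} {f : (Fin n → M) → M} : f ∈ F n → MemTilde F f
  | poly {n : ℕ} (p : MvPolynomial (Fin n) ℚ) : MemTilde F fun x => MvPolynomial.aeval x p
  | add {n : ℕ} {f g : (Fin n → M) → M} :
      MemTilde F f → MemTilde F g → MemTilde F fun x => f x + g x
  | mul {n : ℕ} {f g : (Fin n → M) → M} :
      MemTilde F f → MemTilde F g → MemTilde F fun x => f x * g x
  | smul {n : ℕ} (q : ℚ) {f : (Fin n → M) → M} :
      MemTilde F f → MemTilde F fun x => (q : M) * f x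
  | deriv {n : ℕ} (i : Fin n) {f : (Fin n → M) → M} : MemTilde F f → MemTilde F (pderiv i f)
  | rename {n k : ℕ} (σ : Fin n ↪ Fin k) {f : (Fin n → M) → M} :
      MemTilde F f → MemTilde F fun x : Fin k → M => f fun i => x (σ i)

/-- `R_n`: the `n`-ary functions in `F̃`. -/
def R (F : ∀ n : ℕ, Set ((Fin n → M) → M)) (n : ℕ) : Set ((Fin n → M) → M) :=
  {f | MemTilde F f}

/-- The `0`-definable function `f : U → M`, `U ⊆ Mⁿ` open, is implicitly defined over `F`: it is
one of the components of a continuous `0`-definable map `φ : U → M^m` such that `φ x` is, for all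
`x ∈ U`, a regular zero of the system `g₁(x, ·) = ⋯ = g_m(x, ·) = 0`, with `g_j ∈ R_{n+m}`. -/
def IsImplicitlyDefined (F : ∀ n : ℕ, Set ((Fin n → M) → M)) {n : ℕ} (U : Set (Fin n → M))
    (f : (Fin n → M) → M) : Prop :=
  IsOpen U ∧ DefinableOn F ∅ U f ∧
    ∃ m : ℕ, 1 ≤ m ∧ ∃ (g : Fin m → (Fin (n + m) → M) → M) (φ : Fin m → (Fin n → M) → M),
      (∀ j, g j ∈ R F (n + m)) ∧
      (∀ j, DefinableOn F ∅ U (φ j)) ∧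
      (∀ j, ContinuousOn (φ j) U) ∧
      (∃ j, ∀ x ∈ U, f x = φ j x) ∧
      ∀ x ∈ U, (fun j => φ j x) ∈ Vreg fun j (y : Fin m → M) => g j (Fin.append x y)

/-- The smooth definable function `f : U → M` on the open set `U ⊆ Mⁿ` has controlled derivatives:
there are a definable continuous control function `ω : U → M_{≥ 0}` and `C_k ∈ M`, `E_k ∈ ℕ` with
`|D^α f| ≤ C_{|α|} ω^{E_{|α|}}` on `U` for all multi-indices `α`. Definability is with
parameters. -/
def HasControlledDerivs (F : ∀ n : ℕ, Set ((Fin n → M) → M)) {n : ℕ} (U : Set (Fin n → M))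
    (f : (Fin n → M) → M) : Prop :=
  IsOpen U ∧ DefinableOn F univ U f ∧ IsSmoothOn U f ∧
    ∃ (ω : (Fin n → M) → M) (C : ℕ → M) (E : ℕ → ℕ),
      DefinableOn F univ U ω ∧ ContinuousOn ω U ∧ (∀ x ∈ U, 0 ≤ ω x) ∧
      ∀ (α : Fin n → ℕ), ∀ x ∈ U, |multiDeriv α f x| ≤ C (∑ i, α i) * ω x ^ E (∑ i, α i)

end Main

end ControlledDeriv

/-!
Let `φ : U → M^m` be the continuous definable solution of `g₁(x, y) = ⋯ = g_m(x, y) = 0` and let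
`D = det(∂g/∂y)`, which does not vanish at the points `(x, φ(x))`. Implicit differentiation and
Cramer's rule express the partial derivatives of `φ` as `N(x, φ(x)) / D(x, φ(x))`, where `N` is a
polynomial in partial derivatives of the `g_j`. Hence each iterated partial derivative of `φ_k` is
a fraction `P(x, φ(x)) / D(x, φ(x))^e`, where `P` is in a ring `A` that is closed under partial
differentiation and contains the `g_j` and the coordinates
(`IsRegularSolution.isFraction_iterPDeriv`). All members of `A` can be bounded by multiples of
powers of one definable continuous function `ω ≥ 1`, so all derivatives of `φ_k` are controlled by
`ω(x, φ(x)) + |D(x, φ(x))|⁻¹` (`IsRegularSolution.boundedByPow`).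

The ring `A` is obtained from the hypothesis on `F`: a function is called controlled if it lies in
a set of functions that is closed under partial differentiation and whose members are all bounded by
multiples of powers of one function (`Controlled`). By the Leibniz rule the ring generated by such
a set is again of this kind (`IsDerivClosed.closure`), and finitely many such sets can be merged, so
that all functions in `F̃` are controlled (`MemTilde.controlled`). For the members of `F` itself
the symmetry of mixed partial derivatives is needed, as multi-indices prescribe an order of
differentiation.

The field `M` may be non-archimedean and need not be complete, so calculus is only available for
definable functions. O-minimality gives suprema of definable sets, and from there the usual route
leads to the mean value theorem (`exists_deriv_eq_slope_of_definable`). It yields a form of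
Hadamard's lemma (`IsC1.exists_increment_eq`), from which the chain rule and implicit
differentiation (`hasPDeriv_implicit`) follow, and the symmetry of second derivatives
(`IsC1.pderiv_comm`). The existence part of the implicit function theorem is not needed, since `φ`
is given and continuous.
-/

set_option linter.unusedSectionVars false

namespace ControlledDeriv

/-! ### Definable predicates and functions -/

section Definability

variable {M : Type u} [Field M] [LinearOrder M] {F : ∀ n : ℕ, Set ((Fin n → M) → M)}
  {α β : Type}

/-- The predicate `p` on tuples is definable with parameters in `⟨M̄, F⟩`. -/
def DefPred (F : ∀ n : ℕ, Set ((Fin n → M) → M)) (p : (α → M) → Prop) : Prop :=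
  (univ : Set M).Definable (lang F) {v | p v}

/-- The total function `t` is definable with parameters in `⟨M̄, F⟩`. -/
def DefFun (F : ∀ n : ℕ, Set ((Fin n → M) → M)) (t : (α → M) → M) : Prop :=
  (univ : Set M).DefinableFun (lang F) t

theorem DefPred.and {p q : (α → M) → Prop} (hp : DefPred F p) (hq : DefPred F q) :
    DefPred F fun v => p v ∧ q v :=
  Set.Definable.inter hp hq

theorem DefPred.or {p q : (α → M) → Prop} (hp : DefPred F p) (hq : DefPred F q) :
    DefPred F fun v => p v ∨ q v :=
  Set.Definable.union hp hq

theorem DefPred.not {p : (α → M) → Prop} (hp : DefPred F p) : DefPred F fun v => ¬ p v :=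
  Set.Definable.compl hp

theorem DefPred.imp {p q : (α → M) → Prop} (hp : DefPred F p) (hq : DefPred F q) :
    DefPred F fun v => p v → q v := by
  simpa only [imp_iff_not_or] using hp.not.or hq

/-- The bound variable of an existential quantifier is the coordinate `none` of the extended
context `Option α`. -/
theorem DefPred.ex {p : (α → M) → M → Prop}
    (hp : DefPred F fun w : Option α → M => p (fun i => w (some i)) (w none)) :
    DefPred F fun v => ∃ y, p v y := by
  have h1 := Set.Definable.preimage_comp
    (fun o : Option α => (o.elim (Sum.inr ()) Sum.inl : α ⊕ Unit)) hp
  have h2 := Set.Definable.exists_of_finite h1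
  unfold DefPred
  convert h2 using 1
  ext v
  constructor
  · rintro ⟨y, hy⟩
    exact ⟨fun _ => y, hy⟩
  · rintro ⟨y, hy⟩
    exact ⟨y (), hy⟩

theorem DefPred.all {p : (α → M) → M → Prop}
    (hp : DefPred F fun w : Option α → M => p (fun i => w (some i)) (w none)) :
    DefPred F fun v => ∀ y, p v y := by
  have h := (DefPred.ex (p := fun v y => ¬ p v y) hp.not).not
  simpa using h

/-- Substitution of definable functions into a definable predicate. -/
theorem DefPred.subst [Finite β] {p : (β → M) → Prop} (hp : DefPred F p)
    {t : β → (α → M) → M} (ht : ∀ i, DefFun F (t i)) : DefPred F fun v => p fun i => t i v :=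
  Set.Definable.preimage_map (F := fun v i => t i v) ht hp

theorem DefFun.comp [Finite β] {f : (β → M) → M} (hf : DefFun F f)
    {t : β → (α → M) → M} (ht : ∀ i, DefFun F (t i)) : DefFun F fun v => f fun i => t i v :=
  Set.DefinableFun.comp (g := fun v i => t i v) ht hf

theorem DefFun.var (i : α) : DefFun F fun v : α → M => v i :=
  Set.DefinableFun.proj (lang F)

theorem DefFun.const (c : M) : DefFun F fun _ : α → M => c :=
  (lang F).definableFun_const α (mem_univ c)

theorem DefFun.eq {s t : (α → M) → M} (hs : DefFun F s) (ht : DefFun F t) :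
    DefPred F fun v => s v = t v :=
  Set.DefinableFun.ofPred_eq hs ht

theorem DefFun.of_graph {t : (α → M) → M}
    (h : DefPred F fun w : Option α → M => t (fun i => w (some i)) = w none) : DefFun F t :=
  h

theorem DefFun.ite {p : (α → M) → Prop} [DecidablePred p] (hp : DefPred F p)
    {s t : (α → M) → M} (hs : DefFun F s) (ht : DefFun F t) :
    DefFun F fun v => if p v then s v else t v :=
  Set.DefinableFun.ite (f := s) (g := t) hp hs ht

theorem DefFun.add {s t : (α → M) → M} (hs : DefFun F s) (ht : DefFun F t) :
    DefFun F fun v => s v + t v :=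
  DefFun.comp (f := fun v : Fin 2 → M => v 0 + v 1)
    (Set.DefinableFun.of_empty
      (Set.DefinableFun.fun_symbol (L := lang F) (n := 2) (Sum.inl ringFunc.add)))
    (t := ![s, t]) (by intro i; fin_cases i <;> assumption)

theorem DefFun.mul {s t : (α → M) → M} (hs : DefFun F s) (ht : DefFun F t) :
    DefFun F fun v => s v * t v :=
  DefFun.comp (f := fun v : Fin 2 → M => v 0 * v 1)
    (Set.DefinableFun.of_empty
      (Set.DefinableFun.fun_symbol (L := lang F) (n := 2) (Sum.inl ringFunc.mul)))
    (t := ![s, t]) (by intro i; fin_cases i <;> assumption)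

theorem DefFun.neg {s : (α → M) → M} (hs : DefFun F s) : DefFun F fun v => - s v := by
  simpa using (DefFun.const (F := F) (-1)).mul hs

theorem DefFun.sub {s t : (α → M) → M} (hs : DefFun F s) (ht : DefFun F t) :
    DefFun F fun v => s v - t v := by
  simpa [sub_eq_add_neg] using hs.add ht.neg

theorem DefFun.le {s t : (α → M) → M} (hs : DefFun F s) (ht : DefFun F t) :
    DefPred F fun v => s v ≤ t v := by
  have h : (∅ : Set M).Definable (lang F) {v : Fin 2 → M | v 0 ≤ v 1} := by
    rw [Set.empty_definable_iff]
    refine ⟨Language.Relations.formula₂ (L := lang F) (Language.orderRel.le : _)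
      (Language.Term.var 0) (Language.Term.var 1), ?_⟩
    ext v
    rfl
  exact DefPred.subst (F := F) (p := fun v : Fin 2 → M => v 0 ≤ v 1)
    (Set.Definable.mono h (empty_subset _)) (t := ![s, t])
    (by intro i; fin_cases i <;> assumption)

theorem DefFun.lt {s t : (α → M) → M} (hs : DefFun F s) (ht : DefFun F t) :
    DefPred F fun v => s v < t v := by
  simpa using (ht.le hs).not

theorem DefFun.inv {s : (α → M) → M} (hs : DefFun F s) : DefFun F fun v => (s v)⁻¹ := by
  have h : DefFun F fun v : Unit → M => (v ())⁻¹ := by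
    have h0 : DefFun F fun w : Option Unit → M => w (some ()) := DefFun.var _
    have h1 : DefFun F fun w : Option Unit → M => w none := DefFun.var _
    have := ((h0.mul h1).eq (DefFun.const 1)).or
      ((h0.eq (DefFun.const 0)).and (h1.eq (DefFun.const 0)))
    refine DefFun.of_graph ?_
    convert this using 2 with w
    by_cases hw : w (some ()) = 0
    · simp [hw, eq_comm]
    · simp only [hw, false_and, or_false]
      rw [mul_comm, ← eq_mul_inv_iff_mul_eq₀ hw, one_mul, eq_comm]
  exact h.comp fun _ => hs

theorem DefFun.abs [IsStrictOrderedRing M] {s : (α → M) → M} (hs : DefFun F s) :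
    DefFun F fun v => |s v| := by
  classical
  have := DefFun.ite ((DefFun.const 0).le hs) hs hs.neg
  convert this using 2 with v
  split_ifs with h
  · exact abs_of_nonneg h
  · exact abs_of_nonpos (le_of_not_ge h)

theorem DefFun.sum {ι : Type} (I : Finset ι) {t : ι → (α → M) → M}
    (ht : ∀ i, DefFun F (t i)) : DefFun F fun v => ∑ i ∈ I, t i v := by
  classical
  induction I using Finset.induction_on with
  | empty => simpa using DefFun.const 0
  | insert i I hi ih => simpa [Finset.sum_insert hi] using (ht i).add ih

theorem DefFun.update [DecidableEq α] [Finite α] {f : (α → M) → M} (hf : DefFun F f) {γ : Type}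
    {z : α → (γ → M) → M} (hz : ∀ i, DefFun F (z i)) (i : α) {t : (γ → M) → M} (ht : DefFun F t) :
    DefFun F fun v => f (Function.update (fun j => z j v) i (t v)) := by
  refine hf.comp (t := fun j v => Function.update (fun j => z j v) i (t v) j) fun j => ?_
  by_cases h : j = i
  · subst h
    simpa using ht
  · simpa [h] using hz j

end Definability

/-! ### Definable functions of one variable -/

section OneVariable

variable {M : Type u} [Field M] [LinearOrder M] [IsStrictOrderedRing M]
  {F : ∀ n : ℕ, Set ((Fin n → M) → M)}

/-- Definable completeness: in an o-minimal structure each nonempty definable subset of the line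
that is bounded above has a supremum. -/
theorem exists_isLUB_of_defPred (hO : IsOMinimal (lang F) M) {p : M → Prop}
    (hp : DefPred F fun v : Fin 1 → M => p (v 0)) (hne : ∃ x, p x)
    (hb : ∃ b, ∀ x, p x → x ≤ b) : ∃ s, IsLUB {x | p x} s := by
  obtain ⟨S, hfin, hS, hform⟩ := hO {x | p x} hp
  obtain ⟨b, hb⟩ := hb
  have hbdd : ∀ t ∈ S, ∀ x ∈ t, x ≤ b := fun t ht x hx =>
    hb x (by have : x ∈ {x | p x} := hS ▸ mem_sUnion_of_mem hx ht
             exact this)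
  have key : ∀ t ∈ S, t = ∅ ∨ ∃ s, IsLUB t s := by
    intro t ht
    rcases t.eq_empty_or_nonempty with h | ⟨x, hx⟩
    · exact Or.inl h
    refine Or.inr ?_
    have hbt := hbdd t ht
    rcases hform t ht with ⟨a, rfl⟩ | ⟨a, c, rfl⟩ | ⟨a, rfl⟩ | ⟨a, rfl⟩ | rfl
    · exact ⟨a, isLUB_singleton⟩
    · exact ⟨c, isLUB_Ioo (hx.1.trans hx.2)⟩
    · exact ⟨a, isLUB_Iio⟩
    · have h1 : max x b + 1 ≤ b := hbt _ (lt_of_lt_of_le hx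
        ((le_max_left x b).trans (le_add_of_nonneg_right zero_le_one)))
      exact absurd (lt_of_lt_of_le (lt_add_one b) ((add_le_add_left (le_max_right x b) 1).trans h1))
        (lt_irrefl _)
    · exact absurd (hbt (b + 1) (mem_univ _)) (not_le.2 (lt_add_one b))
  have hall : ∀ T : Set (Set M), T.Finite → T ⊆ S → ⋃₀ T = ∅ ∨ ∃ s, IsLUB (⋃₀ T) s := by
    intro T hT
    induction T, hT using Set.Finite.induction_on with
    | empty => intro _; left; simp
    | @insert t T _ _ ih =>
      intro hsub
      rw [sUnion_insert]
      have ht := key t (hsub (mem_insert _ _))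
      have hT' := ih ((subset_insert _ _).trans hsub)
      rcases ht with rfl | ⟨s, hs⟩
      · simpa using hT'
      · rcases hT' with h | ⟨s', hs'⟩
        · exact Or.inr ⟨s, by simpa [h] using hs⟩
        · exact Or.inr ⟨_, hs.union hs'⟩
  rcases hall S hfin Subset.rfl with h | h
  · obtain ⟨x, hx⟩ := hne
    have : x ∈ {x | p x} := hx
    rw [hS, h] at this
    exact absurd this (notMem_empty x)
  · rwa [hS]

variable [TopologicalSpace M] [OrderTopology M]

/-- The extreme value theorem for definable continuous functions. -/
theorem exists_max_of_definable (hO : IsOMinimal (lang F) M) {h : M → M}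
    (hdef : DefFun F fun v : Fin 1 → M => h (v 0)) {a b : M} (hab : a ≤ b)
    (hc : ContinuousOn h (Icc a b)) : ∃ c ∈ Icc a b, ∀ y ∈ Icc a b, h y ≤ h c := by
  by_contra hno
  push Not at hno
  -- the points `x` such that `h` on `[a, x]` stays below some value of `h` on `[a, b]`
  let p : M → Prop := fun x => (a ≤ x ∧ x ≤ b) ∧
    ∃ z, (a ≤ z ∧ z ≤ b) ∧ ∀ y, (a ≤ y ∧ y ≤ x) → h y < h z
  have hp : DefPred F fun v : Fin 1 → M => p (v 0) := by
    have hcomp : ∀ {γ : Type} (i : γ), DefFun F fun v : γ → M => h (v i) := fun i =>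
      hdef.comp fun _ => DefFun.var i
    refine (((DefFun.const a).le (DefFun.var 0)).and
      ((DefFun.var 0).le (DefFun.const b))).and (DefPred.ex (DefPred.and ?_ (DefPred.all
        (DefPred.imp ?_ ?_))))
    · exact ((DefFun.const a).le (DefFun.var none)).and
        ((DefFun.var none).le (DefFun.const b))
    · exact ((DefFun.const a).le (DefFun.var none)).and
        ((DefFun.var none).le (DefFun.var (some (some 0))))
    · exact (hcomp none).lt (hcomp (some none))
  have hpa : p a := by
    obtain ⟨z, hz, hlt⟩ := hno a ⟨le_rfl, hab⟩
    refine ⟨⟨le_rfl, hab⟩, z, hz, fun y hy => ?_⟩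
    rw [le_antisymm hy.2 hy.1]
    exact hlt
  obtain ⟨s, hs⟩ := exists_isLUB_of_defPred hO hp ⟨a, hpa⟩ ⟨b, fun x hx => hx.1.2⟩
  have has : a ≤ s := hs.1 hpa
  have hsb : s ≤ b := hs.2 fun x hx => hx.1.2
  obtain ⟨z₀, hz₀, hlt₀⟩ := hno s ⟨has, hsb⟩
  have hev : ∀ᶠ y in 𝓝 s, y ∈ Icc a b → h y < h z₀ := by
    have := (hc s ⟨has, hsb⟩).eventually (eventually_lt_nhds hlt₀)
    rwa [eventually_nhdsWithin_iff] at this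
  obtain ⟨l, r, ⟨hl, hr⟩, hlr⟩ := (mem_nhds_iff_exists_Ioo_subset).1 hev
  obtain ⟨x, hx, hlx⟩ : ∃ x, p x ∧ l < x := by
    by_contra hcon
    push Not at hcon
    exact absurd (hs.2 hcon) (not_le.2 hl)
  obtain ⟨hxab, z₁, hz₁, hlt₁⟩ := hx
  -- the larger of the two values works up to any point of `[a, b]` to the left of `r`
  have hext : ∀ t, t ≤ b → a ≤ t → t < r → p t := by
    intro t htb hat htr
    have h2 : ∀ y, a ≤ y ∧ y ≤ t → h y < max (h z₀) (h z₁) := by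
      intro y hy
      rcases le_or_gt y x with hyx | hyx
      · exact lt_max_of_lt_right (hlt₁ y ⟨hy.1, hyx⟩)
      · exact lt_max_of_lt_left (hlr ⟨hlx.trans hyx, hy.2.trans_lt htr⟩ ⟨hy.1, hy.2.trans htb⟩)
    refine ⟨⟨hat, htb⟩, ?_⟩
    rcases max_choice (h z₀) (h z₁) with h | h <;> rw [h] at h2
    · exact ⟨z₀, hz₀, h2⟩
    · exact ⟨z₁, hz₁, h2⟩
  rcases lt_or_eq_of_le hsb with hlt | rfl
  · obtain ⟨t, hst, htr⟩ := exists_between (lt_min hlt hr)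
    exact absurd (hs.1 (hext t (htr.le.trans (min_le_left _ _)) (has.trans hst.le)
      (htr.trans_le (min_le_right _ _)))) (not_le.2 hst)
  · obtain ⟨-, z, hz, hzlt⟩ := hext s le_rfl has hr
    exact lt_irrefl _ (hzlt z hz)

/-- Fermat's theorem: at an interior maximum the derivative vanishes. -/
theorem deriv_eq_zero_of_isMax {h : M → M} {x d : M} {s : Set M} (hs : s ∈ 𝓝 x)
    (hmax : ∀ y ∈ s, h y ≤ h x)
    (hd : Tendsto (fun k => (h (x + k) - h x) / k) (𝓝[≠] 0) (𝓝 d)) : d = 0 := by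
  have hev : ∀ᶠ k in 𝓝 (0 : M), x + k ∈ s := by
    have : Tendsto (fun k : M => x + k) (𝓝 0) (𝓝 x) := by
      simpa using (tendsto_const_nhds (x := x)).add (tendsto_id (α := M) (x := 𝓝 0))
    exact this hs
  refine le_antisymm ?_ ?_
  · have hr : Tendsto (fun k => (h (x + k) - h x) / k) (𝓝[>] 0) (𝓝 d) :=
      hd.mono_left (nhdsWithin_mono 0 fun k (hk : 0 < k) => hk.ne')
    refine le_of_tendsto hr ?_
    filter_upwards [nhdsWithin_le_nhds hev, self_mem_nhdsWithin] with k hk hk0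
    exact div_nonpos_of_nonpos_of_nonneg (sub_nonpos.2 (hmax _ hk)) (le_of_lt hk0)
  · have hl : Tendsto (fun k => (h (x + k) - h x) / k) (𝓝[<] 0) (𝓝 d) :=
      hd.mono_left (nhdsWithin_mono 0 fun k (hk : k < 0) => hk.ne)
    refine ge_of_tendsto hl ?_
    filter_upwards [nhdsWithin_le_nhds hev, self_mem_nhdsWithin] with k hk hk0
    exact div_nonneg_of_nonpos (sub_nonpos.2 (hmax _ hk)) (le_of_lt hk0)

/-- Rolle's theorem for definable functions. -/
theorem rolle_of_definable (hO : IsOMinimal (lang F) M) {h h' : M → M}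
    (hdef : DefFun F fun v : Fin 1 → M => h (v 0)) {a b : M} (hab : a < b)
    (hc : ContinuousOn h (Icc a b)) (heq : h a = h b)
    (hd : ∀ x, Tendsto (fun k => (h (x + k) - h x) / k) (𝓝[≠] 0) (𝓝 (h' x))) :
    ∃ c ∈ Ioo a b, h' c = 0 := by
  obtain ⟨c₁, hc₁, hmax⟩ := exists_max_of_definable hO hdef hab.le hc
  obtain ⟨c₂, hc₂, hmin⟩ := exists_max_of_definable hO (h := fun x => - h x) hdef.neg hab.le hc.neg
  have hIoo : ∀ c ∈ Icc a b, h c ≠ h a → c ∈ Ioo a b := fun c hc hne =>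
    ⟨lt_of_le_of_ne hc.1 fun h => hne (by rw [h]),
      lt_of_le_of_ne hc.2 fun h => hne (by rw [h, heq])⟩
  by_cases h1 : h c₁ = h a
  · by_cases h2 : h c₂ = h a
    · obtain ⟨c, hc⟩ := exists_between hab
      refine ⟨c, hc, deriv_eq_zero_of_isMax (Icc_mem_nhds hc.1 hc.2) (fun y hy => ?_) (hd c)⟩
      have e1 := hmax y hy
      have e2 := hmin c (Ioo_subset_Icc_self hc)
      linarith
    · have hm := hIoo c₂ hc₂ h2
      have := deriv_eq_zero_of_isMax (h := fun x => - h x) (d := - h' c₂)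
        (Icc_mem_nhds hm.1 hm.2) hmin
        ((hd c₂).neg.congr fun k => by ring)
      exact ⟨c₂, hm, by simpa using this⟩
  · have hm := hIoo c₁ hc₁ h1
    exact ⟨c₁, hm, deriv_eq_zero_of_isMax (Icc_mem_nhds hm.1 hm.2) hmax (hd c₁)⟩

/-- The mean value theorem for definable functions, with the endpoints in either order. -/
theorem exists_deriv_eq_slope_of_definable (hO : IsOMinimal (lang F) M) {h h' : M → M}
    (hdef : DefFun F fun v : Fin 1 → M => h (v 0)) (hc : Continuous h)
    (hd : ∀ x, Tendsto (fun k => (h (x + k) - h x) / k) (𝓝[≠] 0) (𝓝 (h' x))) (a b : M) :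
    ∃ c ∈ uIcc a b, h b - h a = h' c * (b - a) := by
  wlog hab : a ≤ b generalizing a b
  · obtain ⟨c, hcm, he⟩ := this b a (le_of_not_ge hab)
    exact ⟨c, uIcc_comm a b ▸ hcm, by linear_combination -he⟩
  rcases hab.eq_or_lt with rfl | hlt
  · exact ⟨a, left_mem_uIcc, by simp⟩
  have hne : b - a ≠ 0 := (sub_pos.2 hlt).ne'
  set q := (h b - h a) / (b - a) with hq
  obtain ⟨c, hcm, he⟩ := rolle_of_definable hO (h := fun x => h x - q * x)
    (h' := fun x => h' x - q) (hdef.sub ((DefFun.const q).mul (DefFun.var 0))) hlt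
    (hc.sub (continuous_const.mul continuous_id)).continuousOn
    (by rw [hq]; field_simp; ring) (fun x => by
      refine ((hd x).sub_const q).congr' ?_
      filter_upwards [self_mem_nhdsWithin] with k hk
      have hk : k ≠ 0 := hk
      field_simp
      ring)
  refine ⟨c, uIcc_of_le hab ▸ Ioo_subset_Icc_self hcm, ?_⟩
  rw [sub_eq_zero.1 he, hq]
  field_simp

end OneVariable

/-! ### Partial derivatives of definable functions -/

section PartialDerivatives

variable {M : Type u} [Field M] [LinearOrder M] [IsStrictOrderedRing M]
  [TopologicalSpace M] [OrderTopology M] {n : ℕ} {i : Fin n} {f g : (Fin n → M) → M}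
  {x : Fin n → M} {c d : M}

theorem neBot_nhdsNE_zero : (𝓝[≠] (0 : M)).NeBot :=
  NeBot.mono (inferInstance : (𝓝[>] (0 : M)).NeBot)
    (nhdsWithin_mono 0 fun k (hk : 0 < k) => hk.ne')

theorem HasPDeriv.unique (hc : HasPDeriv i f x c) (hd : HasPDeriv i f x d) : c = d :=
  have := neBot_nhdsNE_zero (M := M)
  tendsto_nhds_unique hc hd

theorem hasPDeriv_pderiv (h : ∃ d, HasPDeriv i f x d) : HasPDeriv i f x (pderiv i f x) := by
  rw [pderiv, dif_pos h]
  exact h.choose_spec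

theorem HasPDeriv.pderiv_eq (hd : HasPDeriv i f x d) : pderiv i f x = d :=
  (hasPDeriv_pderiv ⟨d, hd⟩).unique hd

theorem HasPDeriv.const (c : M) : HasPDeriv i (fun _ => c) x 0 := by
  simp [HasPDeriv]

theorem HasPDeriv.coord (j : Fin n) : HasPDeriv i (fun y => y j) x (if j = i then 1 else 0) := by
  by_cases h : j = i
  · subst h
    refine (tendsto_const_nhds (x := (1 : M))).congr' ?_ |>.trans (by simp)
    filter_upwards [self_mem_nhdsWithin] with k hk
    have hk : k ≠ 0 := hk
    simp [hk]
  · simp [HasPDeriv, h]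

theorem HasPDeriv.add (hf : HasPDeriv i f x c) (hg : HasPDeriv i g x d) :
    HasPDeriv i (fun y => f y + g y) x (c + d) :=
  (Tendsto.add hf hg).congr fun h => by ring

theorem HasPDeriv.neg (hf : HasPDeriv i f x c) : HasPDeriv i (fun y => - f y) x (-c) :=
  (Tendsto.neg hf).congr fun h => by ring

theorem tendsto_id_nhdsNE : Tendsto (fun h : M => h) (𝓝[≠] 0) (𝓝 0) :=
  tendsto_id.mono_left nhdsWithin_le_nhds

/-- A function is continuous along the lines in whose direction it is differentiable. -/
theorem HasPDeriv.tendsto (hf : HasPDeriv i f x c) :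
    Tendsto (fun h => f (Function.update x i (x i + h))) (𝓝[≠] 0) (𝓝 (f x)) := by
  have h1 : Tendsto (fun h : M => f x +
      (f (Function.update x i (x i + h)) - f x) / h * h) (𝓝[≠] 0) (𝓝 (f x + c * 0)) :=
    tendsto_const_nhds.add (Tendsto.mul hf tendsto_id_nhdsNE)
  rw [mul_zero, add_zero] at h1
  refine h1.congr' ?_
  filter_upwards [self_mem_nhdsWithin] with k hk
  have hk : k ≠ 0 := hk
  field_simp
  ring

theorem HasPDeriv.mul (hf : HasPDeriv i f x c) (hg : HasPDeriv i g x d) :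
    HasPDeriv i (fun y => f y * g y) x (c * g x + f x * d) := by
  refine ((Tendsto.mul hf hg.tendsto).add (Tendsto.const_mul (f x) hg)).congr fun h => ?_
  ring

/-- Partial derivatives at points of an open set only depend on the values on that set. -/
theorem HasPDeriv.congr_of_isOpen {U : Set (Fin n → M)} (hU : IsOpen U) (hfg : EqOn f g U)
    (hx : x ∈ U) (hf : HasPDeriv i f x d) : HasPDeriv i g x d := by
  have ht : Tendsto (fun h : M => Function.update x i (x i + h)) (𝓝 0) (𝓝 x) := by
    have hc : Continuous fun h : M => Function.update x i (x i + h) :=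
      continuous_const.update i (continuous_const.add continuous_id)
    simpa using hc.tendsto 0
  refine Tendsto.congr' ?_ hf
  filter_upwards [nhdsWithin_le_nhds (ht (hU.mem_nhds hx))] with h hh
  rw [hfg hh, hfg hx]

/-- The derivative of a function along a coordinate line. -/
theorem tendsto_line (z : Fin n → M) (hd : ∀ x, ∃ d, HasPDeriv i f x d) (s : M) :
    Tendsto (fun k => (f (Function.update z i (s + k)) - f (Function.update z i s)) / k) (𝓝[≠] 0)
      (𝓝 (pderiv i f (Function.update z i s))) := by
  simpa [HasPDeriv] using hasPDeriv_pderiv (hd (Function.update z i s))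

variable {F : ∀ n : ℕ, Set ((Fin n → M) → M)}

/-- The `ε`-`δ` form of the partial derivative, a first-order condition on `x` and `d`. -/
theorem hasPDeriv_iff : HasPDeriv i f x d ↔ ∀ ε, 0 < ε → ∃ δ, 0 < δ ∧ ∀ h, (h ≠ 0 ∧ |h| < δ) →
    |(f (Function.update x i (x i + h)) - f x) * h⁻¹ - d| < ε := by
  unfold HasPDeriv
  have hb := nhdsWithin_hasBasis (nhds_basis_abs_sub_lt (0 : M)) ({0}ᶜ : Set M)
  rw [hb.tendsto_iff (nhds_basis_abs_sub_lt d)]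
  simp only [sub_zero, mem_inter_iff, mem_compl_iff, mem_singleton_iff, div_eq_mul_inv,
    mem_ofPred_eq]
  exact forall₂_congr fun ε _ => exists_congr fun δ => and_congr_right fun _ =>
    forall_congr' fun h => by rw [and_comm]

/-- Definability of the partial derivatives. As they exist everywhere, the graph of `∂f/∂xᵢ` is
`{(x, d) | HasPDeriv i f x d}`. -/
theorem DefFun.pderiv (hf : DefFun F f) (hd : ∀ x, ∃ d, HasPDeriv i f x d) :
    DefFun F (pderiv i f) := by
  refine DefFun.of_graph ?_
  have key : DefPred F fun w : Option (Fin n) → M =>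
      HasPDeriv i f (fun j => w (some j)) (w none) := by
    simp only [hasPDeriv_iff]
    refine DefPred.all (((DefFun.const 0).lt (DefFun.var none)).imp
      (DefPred.ex (((DefFun.const 0).lt (DefFun.var none)).and (DefPred.all (DefPred.imp
        (((DefFun.var none).eq (DefFun.const 0)).not.and
          ((DefFun.var none).abs.lt (DefFun.var (some none)))) (DefFun.lt (DefFun.abs
          (DefFun.sub (DefFun.mul (DefFun.sub ?_ ?_) (DefFun.var none).inv)
            (DefFun.var (some (some (some none)))))) (DefFun.var (some (some none)))))))))
    · exact hf.update (fun j => DefFun.var (some (some (some (some j))))) i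
        ((DefFun.var (some (some (some (some i))))).add (DefFun.var none))
    · exact hf.comp fun j => DefFun.var (some (some (some (some j))))
  convert key using 2 with w
  constructor
  · intro h
    rw [← h]
    exact hasPDeriv_pderiv (hd _)
  · exact fun h => h.pderiv_eq

end PartialDerivatives

section MeanValue

variable {M : Type u} [Field M] [LinearOrder M] [IsStrictOrderedRing M]
  [TopologicalSpace M] [OrderTopology M] {F : ∀ n : ℕ, Set ((Fin n → M) → M)} {n : ℕ}

/-- `G` is a definable function on all of `Mⁿ` of class `C¹`. -/
structure IsC1 (F : ∀ n : ℕ, Set ((Fin n → M) → M)) (G : (Fin n → M) → M) : Prop where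
  defFun : DefFun F G
  continuous : Continuous G
  hasPDeriv : ∀ i x, ∃ d, HasPDeriv i G x d
  continuous_pderiv : ∀ i, Continuous (pderiv i G)

variable {G : (Fin n → M) → M}

/-- The mean value theorem along a coordinate line. -/
theorem exists_pderiv_eq_slope (hO : IsOMinimal (lang F) M) (hdef : DefFun F G)
    (hc : Continuous G) {i : Fin n} (hd : ∀ x, ∃ d, HasPDeriv i G x d) (z : Fin n → M) (a b : M) :
    ∃ c ∈ uIcc a b, G (Function.update z i b) - G (Function.update z i a) =
      pderiv i G (Function.update z i c) * (b - a) :=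
  exists_deriv_eq_slope_of_definable hO (h := fun s => G (Function.update z i s))
    (h' := fun s => pderiv i G (Function.update z i s))
    (hdef.update (fun j => DefFun.const (z j)) i (DefFun.var 0))
    (hc.comp (continuous_const.update i continuous_id)) (tendsto_line z hd) a b

theorem tendsto_of_abs_sub_le {ι : Type*} {l : Filter ι} {p q : ι → M} {a : M}
    (hq : Tendsto q l (𝓝 a)) (h : ∀ t, |p t - a| ≤ |q t - a|) : Tendsto p l (𝓝 a) := by
  have h1 : Tendsto (fun t => |q t - a|) l (𝓝 0) := by
    simpa using (hq.sub_const a).abs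
  have h2 : Tendsto (fun t => p t - a) l (𝓝 0) :=
    (tendsto_zero_iff_abs_tendsto_zero _).2
      (tendsto_of_tendsto_of_tendsto_of_le_of_le tendsto_const_nhds h1 (fun _ => abs_nonneg _) h)
  simpa using h2.add_const a

/-- Hadamard's lemma at a point: the increments of a `C¹` function are linear combinations of the
increments of the variables, with coefficients that tend to the gradient. -/
theorem IsC1.exists_increment_eq (hO : IsOMinimal (lang F) M) (hG : IsC1 F G) (z : Fin n → M) :
    ∃ q : (Fin n → M) → Fin n → M, (∀ k, Tendsto (fun z' => q z' k) (𝓝 z) (𝓝 (pderiv k G z))) ∧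
      ∀ z', G z' - G z = ∑ k, q z' k * (z' k - z k) := by
  -- the increment is split along the coordinate directions:
  -- `w z' k` has its first `k` coordinates from `z'` and the others from `z`
  let w : (Fin n → M) → ℕ → Fin n → M := fun z' k j => if (j : ℕ) < k then z' j else z j
  have hstep : ∀ z' (k : Fin n), ∃ ξ : Fin n → M, (∀ j, |ξ j - z j| ≤ |z' j - z j|) ∧
      G (w z' (k + 1)) - G (w z' k) = pderiv k G ξ * (z' k - z k) := by
    intro z' k
    obtain ⟨c, hc, he⟩ := exists_pderiv_eq_slope hO hG.defFun hG.continuous (hG.hasPDeriv k)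
      (w z' k) (z k) (z' k)
    refine ⟨Function.update (w z' k) k c, fun j => ?_, ?_⟩
    · by_cases hj : j = k
      · subst hj
        simpa using abs_sub_left_of_mem_uIcc hc
      · simp only [Function.update_of_ne hj, w]
        split_ifs
        · exact le_rfl
        · simp
    · rw [← he]
      congr 2
      · ext j
        by_cases hj : j = k
        · subst hj
          simp [w]
        · have hj' : (j : ℕ) ≠ k := fun h => hj (Fin.ext h)
          simp only [Function.update_of_ne hj, w, Nat.lt_succ_iff_lt_or_eq, hj', or_false]
      · ext j
        by_cases hj : j = k
        · subst hj
          simp [w]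
        · simp [Function.update_of_ne hj]
  choose ξ hξ hinc using hstep
  refine ⟨fun z' k => pderiv k G (ξ z' k), fun k => ?_, fun z' => ?_⟩
  · refine ((hG.continuous_pderiv k).tendsto z).comp (tendsto_pi_nhds.2 fun j => ?_)
    exact tendsto_of_abs_sub_le ((continuous_apply j).tendsto z) fun z' => hξ z' k j
  · have h1 := Finset.sum_range_sub (fun k => G (w z' k)) n
    have hn : w z' n = z' := by ext j; simp [w]
    have h0 : w z' 0 = z := by ext j; simp [w]
    rw [hn, h0, Finset.sum_range] at h1
    rw [← h1]
    exact Finset.sum_congr rfl fun k _ => hinc z' k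

/-- The chain rule for a `C¹` function along a curve. -/
theorem IsC1.tendsto_comp (hO : IsOMinimal (lang F) M) (hG : IsC1 F G) {z : Fin n → M}
    {γ : M → Fin n → M} (hγ : Tendsto γ (𝓝[≠] 0) (𝓝 z)) {d : Fin n → M}
    (hd : ∀ k, Tendsto (fun h => (γ h k - z k) / h) (𝓝[≠] 0) (𝓝 (d k))) :
    Tendsto (fun h => (G (γ h) - G z) / h) (𝓝[≠] 0) (𝓝 (∑ k, pderiv k G z * d k)) := by
  obtain ⟨q, hq, he⟩ := hG.exists_increment_eq hO z
  refine (tendsto_finsetSum _ fun k _ => ((hq k).comp hγ).mul (hd k)).congr fun h => ?_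
  rw [he, Finset.sum_div]
  exact Finset.sum_congr rfl fun k _ => by simp [mul_div_assoc]

/-- A mixed second difference is a value of the mixed second partial derivative. -/
theorem IsC1.exists_second_difference (hO : IsOMinimal (lang F) M) (hG : IsC1 F G) {i j : Fin n}
    (hij : i ≠ j) (hG' : IsC1 F (pderiv i G)) (x : Fin n → M) (h : M) :
    ∃ p : Fin n → M, (∀ k, |p k - x k| ≤ |h|) ∧
      (G (Function.update (Function.update x j (x j + h)) i (x i + h))
        - G (Function.update x j (x j + h))) - (G (Function.update x i (x i + h)) - G x) =
      pderiv j (pderiv i G) p * (h * h) := by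
  set x' := Function.update x j (x j + h) with hx'
  obtain ⟨c, hc, he⟩ := exists_deriv_eq_slope_of_definable hO
    (h := fun s => G (Function.update x' i s) - G (Function.update x i s))
    (h' := fun s => pderiv i G (Function.update x' i s) - pderiv i G (Function.update x i s))
    ((hG.defFun.update (fun j => DefFun.const (x' j)) i (DefFun.var 0)).sub
      (hG.defFun.update (fun j => DefFun.const (x j)) i (DefFun.var 0)))
    ((hG.continuous.comp (continuous_const.update i continuous_id)).sub
      (hG.continuous.comp (continuous_const.update i continuous_id)))
    (fun s => ((tendsto_line x' (hG.hasPDeriv i) s).sub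
      (tendsto_line x (hG.hasPDeriv i) s)).congr fun k => by ring) (x i) (x i + h)
  obtain ⟨e, he', hee⟩ := exists_pderiv_eq_slope hO hG'.defFun hG'.continuous (hG'.hasPDeriv j)
    (Function.update x i c) (x j) (x j + h)
  refine ⟨Function.update (Function.update x i c) j e, fun k => ?_, ?_⟩
  · by_cases hk : k = j
    · subst hk
      simpa using abs_sub_left_of_mem_uIcc he'
    · rw [Function.update_of_ne hk]
      by_cases hk' : k = i
      · subst hk'
        simpa using abs_sub_left_of_mem_uIcc hc
      · simp [hk']
  · have e1 : Function.update x' i (x i) = x' := by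
      rw [hx', Function.update_comm hij.symm, Function.update_eq_self]
    have e2 : Function.update (Function.update x i c) j (x j) = Function.update x i c := by
      rw [Function.update_comm hij, Function.update_eq_self]
    have e3 : Function.update (Function.update x i c) j (x j + h) = Function.update x' i c :=
      Function.update_comm hij _ _ _
    rw [e2, e3] at hee
    simp only [e1, Function.update_eq_self, add_sub_cancel_left] at he hee
    linear_combination he + h * hee

/-- The symmetry of the mixed second partial derivatives. -/
theorem IsC1.pderiv_comm (hO : IsOMinimal (lang F) M) (hG : IsC1 F G)
    (hG' : ∀ i, IsC1 F (pderiv i G)) (i j : Fin n) :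
    pderiv i (pderiv j G) = pderiv j (pderiv i G) := by
  rcases eq_or_ne i j with rfl | hij
  · rfl
  ext x
  choose p hp hpe using hG.exists_second_difference hO hij (hG' i) x
  choose q hq hqe using hG.exists_second_difference hO hij.symm (hG' j) x
  have hlim : ∀ r : M → Fin n → M, (∀ h k, |r h k - x k| ≤ |h|) → Tendsto r (𝓝[≠] 0) (𝓝 x) :=
    fun r hr => tendsto_pi_nhds.2 fun k =>
      tendsto_of_abs_sub_le (q := fun h => x k + h)
        (by simpa using tendsto_const_nhds.add (tendsto_id_nhdsNE (M := M)))
        fun h => by simpa using hr h k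
  have hP := (((hG' i).continuous_pderiv j).tendsto x).comp (hlim p hp)
  have hQ := (((hG' j).continuous_pderiv i).tendsto x).comp (hlim q hq)
  have := neBot_nhdsNE_zero (M := M)
  refine tendsto_nhds_unique (hQ.congr' ?_) hP
  filter_upwards [self_mem_nhdsWithin] with h hh
  have hh : h ≠ 0 := hh
  refine mul_right_cancel₀ (mul_ne_zero hh hh) ?_
  have h1 := hpe h
  rw [Function.update_comm hij.symm] at h1
  simp only [Function.comp_apply]
  linear_combination h1 - hqe h

/-- The iterated partial derivatives of a definable smooth function are definable and `C¹`. -/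
theorem IsSmoothOn.isC1_iterPDeriv (hdef : DefFun F G) (hG : IsSmoothOn univ G)
    (l : List (Fin n)) : IsC1 F (iterPDeriv l G) where
  defFun := by
    induction l with
    | nil => exact hdef
    | cons i l ih => exact ih.pderiv fun x => (hG l).2 x (mem_univ x) i
  continuous := continuousOn_univ.1 (hG l).1
  hasPDeriv i x := (hG l).2 x (mem_univ x) i
  continuous_pderiv i := continuousOn_univ.1 (hG (i :: l)).1

/-- Iterated partial derivatives do not depend on the order of differentiation. -/
theorem IsSmoothOn.iterPDeriv_perm (hO : IsOMinimal (lang F) M) (hdef : DefFun F G)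
    (hG : IsSmoothOn univ G) {l l' : List (Fin n)} (h : l.Perm l') :
    iterPDeriv l G = iterPDeriv l' G := by
  induction h with
  | nil => rfl
  | cons i _ ih => exact congrArg (pderiv i) ih
  | swap i j l =>
    exact (hG.isC1_iterPDeriv hdef l).pderiv_comm hO
      (fun k => hG.isC1_iterPDeriv hdef (k :: l)) j i
  | trans _ _ ih₁ ih₂ => exact ih₁.trans ih₂

theorem IsSmoothOn.iterPDeriv_eq_multiDeriv (hO : IsOMinimal (lang F) M) (hdef : DefFun F G)
    (hG : IsSmoothOn univ G) (l : List (Fin n)) :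
    iterPDeriv l G = multiDeriv (fun i => l.count i) G := by
  refine hG.iterPDeriv_perm hO hdef (List.perm_iff_count.2 fun a => ?_)
  rw [List.count_flatMap]
  have : (List.count a ∘ fun i => List.replicate (List.count i l) i) =
      fun i => if i = a then l.count a else 0 := by
    ext i
    by_cases h : i = a
    · simp [h]
    · simp [List.count_replicate, h]
  rw [this, ← List.ofFn_eq_map, List.sum_ofFn]
  simp

end MeanValue

/-! ### Controlled rings of functions -/

section PowerBounds

variable {M : Type u} [Field M] [LinearOrder M] [IsStrictOrderedRing M] {X : Type*}
  {U : Set X} {ω f g : X → M}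

/-- On `U`, the function `f` is bounded by a multiple of a power of `ω`. The constant is required to
be nonnegative, so that it need not be replaced by its absolute value when `U` is empty. -/
def BoundedByPow (U : Set X) (ω f : X → M) : Prop :=
  ∃ (C : M) (E : ℕ), 0 ≤ C ∧ ∀ x ∈ U, |f x| ≤ C * ω x ^ E

theorem BoundedByPow.const (c : M) : BoundedByPow U ω fun _ => c :=
  ⟨|c|, 0, abs_nonneg c, fun x _ => by simp⟩

theorem BoundedByPow.self (hω : ∀ x ∈ U, 1 ≤ ω x) : BoundedByPow U ω ω :=
  ⟨1, 1, zero_le_one, fun x hx => by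
    rw [abs_of_nonneg (zero_le_one.trans (hω x hx)), one_mul, pow_one]⟩

theorem BoundedByPow.of_abs_le (hf : BoundedByPow U ω f) (h : ∀ x ∈ U, |g x| ≤ |f x|) :
    BoundedByPow U ω g := by
  obtain ⟨C, E, hC, hb⟩ := hf
  exact ⟨C, E, hC, fun x hx => (h x hx).trans (hb x hx)⟩

theorem BoundedByPow.neg (hf : BoundedByPow U ω f) : BoundedByPow U ω fun x => - f x :=
  hf.of_abs_le fun x _ => by simp

theorem BoundedByPow.add (hω : ∀ x ∈ U, 1 ≤ ω x) (hf : BoundedByPow U ω f)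
    (hg : BoundedByPow U ω g) : BoundedByPow U ω fun x => f x + g x := by
  obtain ⟨C, E, hC, hb⟩ := hf
  obtain ⟨C', E', hC', hb'⟩ := hg
  refine ⟨C + C', E + E', add_nonneg hC hC', fun x hx => (abs_add_le _ _).trans ?_⟩
  rw [add_mul]
  have h1 := hω x hx
  exact add_le_add
    ((hb x hx).trans (mul_le_mul_of_nonneg_left (pow_le_pow_right₀ h1 (Nat.le_add_right _ _)) hC))
    ((hb' x hx).trans (mul_le_mul_of_nonneg_left (pow_le_pow_right₀ h1 (Nat.le_add_left _ _)) hC'))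

theorem BoundedByPow.mul (hf : BoundedByPow U ω f) (hg : BoundedByPow U ω g) :
    BoundedByPow U ω fun x => f x * g x := by
  obtain ⟨C, E, hC, hb⟩ := hf
  obtain ⟨C', E', hC', hb'⟩ := hg
  refine ⟨C * C', E + E', mul_nonneg hC hC', fun x hx => ?_⟩
  rw [abs_mul]
  calc |f x| * |g x| ≤ (C * ω x ^ E) * (C' * ω x ^ E') :=
        mul_le_mul (hb x hx) (hb' x hx) (abs_nonneg _) ((abs_nonneg _).trans (hb x hx))
    _ = C * C' * ω x ^ (E + E') := by ring

theorem BoundedByPow.pow (hf : BoundedByPow U ω f) (k : ℕ) :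
    BoundedByPow U ω fun x => f x ^ k := by
  induction k with
  | zero => simpa using BoundedByPow.const 1
  | succ k ih => simpa [pow_succ] using ih.mul hf

theorem BoundedByPow.mono {ω' : X → M} (hω : ∀ x ∈ U, 0 ≤ ω x) (h : ∀ x ∈ U, ω x ≤ ω' x)
    (hf : BoundedByPow U ω f) : BoundedByPow U ω' f := by
  obtain ⟨C, E, hC, hb⟩ := hf
  exact ⟨C, E, hC, fun x hx => (hb x hx).trans
    (mul_le_mul_of_nonneg_left (pow_le_pow_left₀ (hω x hx) (h x hx) E) hC)⟩

theorem BoundedByPow.comp {Y : Type*} {V : Set Y} (hf : BoundedByPow U ω f) {t : Y → X}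
    (ht : ∀ y ∈ V, t y ∈ U) : BoundedByPow V (fun y => ω (t y)) fun y => f (t y) := by
  obtain ⟨C, E, hC, hb⟩ := hf
  exact ⟨C, E, hC, fun y hy => hb _ (ht y hy)⟩

end PowerBounds

section Controlled

variable {M : Type u} [Field M] [LinearOrder M] [IsStrictOrderedRing M]
  [TopologicalSpace M] [OrderTopology M] {F : ∀ n : ℕ, Set ((Fin n → M) → M)} {n : ℕ}

/-- A set of definable functions on `Mⁿ` that is closed under partial differentiation, all of whose
members are bounded by multiples of powers of one function `ω`. -/
structure IsDerivClosed (F : ∀ n : ℕ, Set ((Fin n → M) → M)) (ω : (Fin n → M) → M)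
    (S : Set ((Fin n → M) → M)) : Prop where
  defFun : ∀ f ∈ S, DefFun F f
  continuous : ∀ f ∈ S, Continuous f
  hasPDeriv : ∀ f ∈ S, ∀ i x, ∃ d, HasPDeriv i f x d
  pderiv_mem : ∀ f ∈ S, ∀ i, pderiv i f ∈ S
  bounded : ∀ f ∈ S, BoundedByPow univ ω f

variable {ω : (Fin n → M) → M} {S : Set ((Fin n → M) → M)}

theorem IsDerivClosed.isC1 (hS : IsDerivClosed F ω S) {f : (Fin n → M) → M} (hf : f ∈ S) :
    IsC1 F f where
  defFun := hS.defFun f hf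
  continuous := hS.continuous f hf
  hasPDeriv := hS.hasPDeriv f hf
  continuous_pderiv i := hS.continuous _ (hS.pderiv_mem f hf i)

theorem IsDerivClosed.mono {ω' : (Fin n → M) → M} (hω : ∀ x, 0 ≤ ω x) (h : ∀ x, ω x ≤ ω' x)
    (hS : IsDerivClosed F ω S) : IsDerivClosed F ω' S :=
  { hS with bounded := fun f hf => (hS.bounded f hf).mono (fun x _ => hω x) fun x _ => h x }

theorem IsDerivClosed.iUnion {ι : Type*} {S : ι → Set ((Fin n → M) → M)}
    (hS : ∀ j, IsDerivClosed F ω (S j)) : IsDerivClosed F ω (⋃ j, S j) where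
  defFun f hf := by obtain ⟨j, hj⟩ := mem_iUnion.1 hf; exact (hS j).defFun f hj
  continuous f hf := by obtain ⟨j, hj⟩ := mem_iUnion.1 hf; exact (hS j).continuous f hj
  hasPDeriv f hf := by obtain ⟨j, hj⟩ := mem_iUnion.1 hf; exact (hS j).hasPDeriv f hj
  pderiv_mem f hf i := by
    obtain ⟨j, hj⟩ := mem_iUnion.1 hf
    exact mem_iUnion.2 ⟨j, (hS j).pderiv_mem f hj i⟩
  bounded f hf := by obtain ⟨j, hj⟩ := mem_iUnion.1 hf; exact (hS j).bounded f hj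

/-- The Leibniz rule: the ring generated by a set that is closed under partial differentiation is
closed under it as well. -/
theorem IsDerivClosed.closure (hω : ∀ x, 1 ≤ ω x) (hS : IsDerivClosed F ω S) :
    IsDerivClosed F ω (Subring.closure S : Set ((Fin n → M) → M)) := by
  have key : ∀ f ∈ Subring.closure S, (DefFun F f ∧ Continuous f) ∧
      (∀ i, ∃ f' ∈ Subring.closure S, ∀ x, HasPDeriv i f x (f' x)) ∧ BoundedByPow univ ω f := by
    intro f hf
    induction hf using Subring.closure_induction with
    | mem f hf =>
      exact ⟨⟨hS.defFun f hf, hS.continuous f hf⟩, fun i => ⟨pderiv i f,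
        Subring.subset_closure (hS.pderiv_mem f hf i),
        fun x => hasPDeriv_pderiv (hS.hasPDeriv f hf i x)⟩, hS.bounded f hf⟩
    | zero =>
      exact ⟨⟨DefFun.const 0, continuous_const⟩,
        fun i => ⟨0, Subring.zero_mem _, fun x => HasPDeriv.const 0⟩, BoundedByPow.const 0⟩
    | one =>
      exact ⟨⟨DefFun.const 1, continuous_const⟩,
        fun i => ⟨0, Subring.zero_mem _, fun x => HasPDeriv.const 1⟩, BoundedByPow.const 1⟩
    | add f g _ _ hf hg =>
      refine ⟨⟨hf.1.1.add hg.1.1, hf.1.2.add hg.1.2⟩, fun i => ?_,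
        hf.2.2.add (fun x _ => hω x) hg.2.2⟩
      obtain ⟨f', hf', hfd⟩ := hf.2.1 i
      obtain ⟨g', hg', hgd⟩ := hg.2.1 i
      exact ⟨f' + g', Subring.add_mem _ hf' hg', fun x => (hfd x).add (hgd x)⟩
    | neg f _ hf =>
      refine ⟨⟨hf.1.1.neg, hf.1.2.neg⟩, fun i => ?_, hf.2.2.neg⟩
      obtain ⟨f', hf', hfd⟩ := hf.2.1 i
      exact ⟨-f', Subring.neg_mem _ hf', fun x => (hfd x).neg⟩
    | mul f g hfm hgm hf hg =>
      refine ⟨⟨hf.1.1.mul hg.1.1, hf.1.2.mul hg.1.2⟩, fun i => ?_, hf.2.2.mul hg.2.2⟩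
      obtain ⟨f', hf', hfd⟩ := hf.2.1 i
      obtain ⟨g', hg', hgd⟩ := hg.2.1 i
      exact ⟨f' * g + f * g', Subring.add_mem _ (Subring.mul_mem _ hf' hgm)
        (Subring.mul_mem _ hfm hg'), fun x => (hfd x).mul (hgd x)⟩
  refine ⟨fun f hf => (key f hf).1.1, fun f hf => (key f hf).1.2, fun f hf i x => ?_,
    fun f hf i => ?_, fun f hf => (key f hf).2.2⟩
  · obtain ⟨f', -, h⟩ := (key f hf).2.1 i
    exact ⟨_, h x⟩
  · obtain ⟨f', hf', h⟩ := (key f hf).2.1 i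
    rwa [show pderiv i f = f' from funext fun x => (h x).pderiv_eq]

/-- The function `f` belongs to a set that is closed under partial differentiation and controlled
by a definable continuous function `ω ≥ 1`. For functions on all of `Mⁿ` this is a form of having
controlled derivatives that does not mention multi-indices. -/
def Controlled (F : ∀ n : ℕ, Set ((Fin n → M) → M)) (f : (Fin n → M) → M) : Prop :=
  ∃ (ω : (Fin n → M) → M) (S : Set ((Fin n → M) → M)), (DefFun F ω ∧ Continuous ω) ∧
    (∀ x, 1 ≤ ω x) ∧ IsDerivClosed F ω S ∧ f ∈ S

/-- Finitely many controlled functions lie in one controlled ring. -/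
theorem exists_subring_of_controlled {ι : Type} [Fintype ι] {g : ι → (Fin n → M) → M}
    (hg : ∀ j, Controlled F (g j)) :
    ∃ (ω : (Fin n → M) → M) (A : Subring ((Fin n → M) → M)), (DefFun F ω ∧ Continuous ω) ∧
      (∀ x, 1 ≤ ω x) ∧ IsDerivClosed F ω (A : Set ((Fin n → M) → M)) ∧ ∀ j, g j ∈ A := by
  choose ω S hω h1 hS hgS using hg
  have h0 : ∀ j x, 0 ≤ ω j x := fun j x => zero_le_one.trans (h1 j x)
  have hle : ∀ x, 1 ≤ 1 + ∑ j, ω j x := fun x =>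
    le_add_of_nonneg_right (Finset.sum_nonneg fun j _ => h0 j x)
  refine ⟨fun x => 1 + ∑ j, ω j x, Subring.closure (⋃ j, S j),
    ⟨(DefFun.const 1).add (DefFun.sum _ fun j => (hω j).1),
      continuous_const.add (continuous_finsetSum _ fun j _ => (hω j).2)⟩, hle,
    (IsDerivClosed.iUnion fun j => (hS j).mono (h0 j) fun x => ?_).closure hle,
    fun j => Subring.subset_closure (mem_iUnion.2 ⟨j, hgS j⟩)⟩
  exact (Finset.single_le_sum (f := fun j => ω j x) (fun j _ => h0 j x) (Finset.mem_univ j)).trans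
    (le_add_of_nonneg_left zero_le_one)

theorem Controlled.add {f g : (Fin n → M) → M} (hf : Controlled F f) (hg : Controlled F g) :
    Controlled F fun x => f x + g x := by
  obtain ⟨ω, A, hω, h1, hA, hm⟩ := exists_subring_of_controlled (g := ![f, g])
    (by intro j; fin_cases j <;> assumption)
  exact ⟨ω, A, hω, h1, hA, A.add_mem (hm 0) (hm 1)⟩

theorem Controlled.mul {f g : (Fin n → M) → M} (hf : Controlled F f) (hg : Controlled F g) :
    Controlled F fun x => f x * g x := by
  obtain ⟨ω, A, hω, h1, hA, hm⟩ := exists_subring_of_controlled (g := ![f, g])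
    (by intro j; fin_cases j <;> assumption)
  exact ⟨ω, A, hω, h1, hA, A.mul_mem (hm 0) (hm 1)⟩

theorem pderiv_const (i : Fin n) (c : M) : pderiv i (fun _ : Fin n → M => c) = fun _ => 0 :=
  funext fun _ => (HasPDeriv.const c).pderiv_eq

theorem isDerivClosed_const (ω : (Fin n → M) → M) :
    IsDerivClosed F ω (range fun (c : M) (_ : Fin n → M) => c) where
  defFun := by rintro _ ⟨c, rfl⟩; exact DefFun.const c
  continuous := by rintro _ ⟨c, rfl⟩; exact continuous_const
  hasPDeriv := by rintro _ ⟨c, rfl⟩ i x; exact ⟨0, HasPDeriv.const c⟩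
  pderiv_mem := by rintro _ ⟨c, rfl⟩ i; exact ⟨0, (pderiv_const i c).symm⟩
  bounded := by rintro _ ⟨c, rfl⟩; exact BoundedByPow.const c

theorem Controlled.const (c : M) : Controlled F fun _ : Fin n → M => c :=
  ⟨fun _ => 1, _, ⟨DefFun.const 1, continuous_const⟩, fun _ => le_rfl, isDerivClosed_const _,
    c, rfl⟩

theorem Controlled.coord (j : Fin n) : Controlled F fun x : Fin n → M => x j := by
  have h1 : ∀ x : Fin n → M, 1 ≤ 1 + |x j| := fun x => le_add_of_nonneg_right (abs_nonneg _)
  have hpd : ∀ i, pderiv i (fun x : Fin n → M => x j) = fun _ => if j = i then 1 else 0 :=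
    fun i => funext fun x => (HasPDeriv.coord j).pderiv_eq
  refine ⟨fun x => 1 + |x j|, insert (fun x => x j) (range fun (c : M) (_ : Fin n → M) => c),
    ⟨(DefFun.const 1).add (DefFun.var j).abs,
      continuous_const.add (continuous_apply j).abs⟩, h1, ?_, mem_insert _ _⟩
  have hc := isDerivClosed_const (F := F) fun x : Fin n → M => 1 + |x j|
  refine ⟨?_, ?_, ?_, ?_, ?_⟩ <;> rintro f (rfl | hf)
  · exact DefFun.var j
  · exact hc.defFun f hf
  · exact continuous_apply j
  · exact hc.continuous f hf
  · exact fun i x => ⟨_, HasPDeriv.coord j⟩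
  · exact hc.hasPDeriv f hf
  · exact fun i => Or.inr ⟨_, (hpd i).symm⟩
  · exact fun i => Or.inr (hc.pderiv_mem f hf i)
  · refine (BoundedByPow.self fun x _ => h1 x).of_abs_le fun x _ => ?_
    rw [abs_of_nonneg (zero_le_one.trans (h1 x))]
    exact le_add_of_nonneg_left zero_le_one
  · exact hc.bounded f hf

theorem Controlled.mvPolynomial (p : MvPolynomial (Fin n) ℚ) :
    Controlled F fun x : Fin n → M => MvPolynomial.aeval x p := by
  induction p using MvPolynomial.induction_on with
  | C q => simpa using Controlled.const (algebraMap ℚ M q)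
  | add p q hp hq => simpa using hp.add hq
  | mul_X p j hp => simpa using hp.mul (Controlled.coord j)

theorem Controlled.pderiv {f : (Fin n → M) → M} (hf : Controlled F f) (i : Fin n) :
    Controlled F (pderiv i f) := by
  obtain ⟨ω, S, hω, h1, hS, hfS⟩ := hf
  exact ⟨ω, S, hω, h1, hS, hS.pderiv_mem f hfS i⟩

theorem HasPDeriv.rename {k : ℕ} {σ : Fin n ↪ Fin k} {f : (Fin n → M) → M} {x : Fin k → M}
    {i : Fin n} {d : M} (hf : HasPDeriv i f (fun j => x (σ j)) d) :
    HasPDeriv (σ i) (fun y : Fin k → M => f fun j => y (σ j)) x d := by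
  refine hf.congr fun h => ?_
  congr 3
  ext j
  by_cases hj : j = i
  · subst hj; simp
  · simp [hj, σ.injective.ne hj]

/-- A function does not vary in the direction of a dummy variable. -/
theorem HasPDeriv.of_forall_ne {k : ℕ} {σ : Fin n → Fin k} (f : (Fin n → M) → M) (x : Fin k → M)
    {i : Fin k} (hi : ∀ j, σ j ≠ i) : HasPDeriv i (fun y : Fin k → M => f fun j => y (σ j)) x 0 := by
  simp [HasPDeriv, Function.update_of_ne (hi _)]

theorem Controlled.rename {k : ℕ} (σ : Fin n ↪ Fin k) {f : (Fin n → M) → M}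
    (hf : Controlled F f) : Controlled F fun x : Fin k → M => f fun i => x (σ i) := by
  obtain ⟨ω, S, hω, h1, hS, hfS⟩ := hf
  have hcσ : Continuous fun (x : Fin k → M) i => x (σ i) :=
    continuous_pi fun i => continuous_apply (σ i)
  have hpd : ∀ f ∈ S, ∀ i x, HasPDeriv (σ i) (fun y : Fin k → M => f fun j => y (σ j)) x
      (ControlledDeriv.pderiv i f fun j => x (σ j)) := fun f hf i x =>
    (hasPDeriv_pderiv (hS.hasPDeriv f hf i _)).rename
  refine ⟨fun x => ω fun i => x (σ i),
    insert (fun _ => 0) ((fun (f : (Fin n → M) → M) x => f fun i => x (σ i)) '' S),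
    ⟨hω.1.comp fun i => DefFun.var (σ i), hω.2.comp hcσ⟩, fun x => h1 _, ?_,
    Or.inr ⟨f, hfS, rfl⟩⟩
  refine ⟨?_, ?_, ?_, ?_, ?_⟩ <;> rintro _ (rfl | ⟨f, hf, rfl⟩)
  · exact DefFun.const 0
  · exact (hS.defFun f hf).comp fun i => DefFun.var (σ i)
  · exact continuous_const
  · exact (hS.continuous f hf).comp hcσ
  · exact fun i x => ⟨0, HasPDeriv.const 0⟩
  · intro i x
    by_cases h : ∃ j, σ j = i
    · obtain ⟨j, rfl⟩ := h
      exact ⟨_, hpd f hf j x⟩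
    · push Not at h
      exact ⟨0, HasPDeriv.of_forall_ne f x h⟩
  · exact fun i => Or.inl (pderiv_const i 0)
  · intro i
    by_cases h : ∃ j, σ j = i
    · obtain ⟨j, rfl⟩ := h
      exact Or.inr ⟨_, hS.pderiv_mem f hf j, funext fun x => ((hpd f hf j x).pderiv_eq).symm⟩
    · push Not at h
      exact Or.inl (funext fun x => (HasPDeriv.of_forall_ne f x h).pderiv_eq)
  · exact BoundedByPow.const 0
  · exact (hS.bounded f hf).comp fun _ _ => mem_univ _

theorem DefinableOn.defFun {f : (Fin n → M) → M} (hf : DefinableOn F univ univ f) :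
    DefFun F f := by
  refine DefFun.of_graph ?_
  have := Set.Definable.preimage_comp
    (fun i : Fin (n + 1) => (Fin.lastCases none some i : Option (Fin n))) hf
  unfold DefPred
  convert this using 1
  ext w
  simp [Fin.init_def]

/-- The family of all iterated partial derivatives of a smooth function on `Mⁿ` with controlled
derivatives is controlled; here the order of the differentiations is immaterial. -/
theorem HasControlledDerivs.controlled (hO : IsOMinimal (lang F) M) {f : (Fin n → M) → M}
    (hf : HasControlledDerivs F univ f) : Controlled F f := by
  obtain ⟨-, hdef, hsm, ω, C, E, hωd, hωc, hω0, hb⟩ := hf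
  have h1 : ∀ x, 1 ≤ 1 + ω x := fun x => le_add_of_nonneg_right (hω0 x (mem_univ x))
  have hC1 := hsm.isC1_iterPDeriv hdef.defFun
  refine ⟨fun x => 1 + ω x, range fun l => iterPDeriv l f,
    ⟨(DefFun.const 1).add hωd.defFun, continuous_const.add (continuousOn_univ.1 hωc)⟩, h1, ?_,
    [], rfl⟩
  refine ⟨?_, ?_, ?_, ?_, ?_⟩ <;> rintro _ ⟨l, rfl⟩
  · exact (hC1 l).defFun
  · exact (hC1 l).continuous
  · exact (hC1 l).hasPDeriv
  · exact fun i => ⟨i :: l, rfl⟩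
  · refine ⟨|C (∑ i, l.count i)|, E (∑ i, l.count i), abs_nonneg _, fun x _ => ?_⟩
    have h0 := hω0 x (mem_univ x)
    have := hb (fun i => l.count i) x (mem_univ x)
    simp only [hsm.iterPDeriv_eq_multiDeriv hO hdef.defFun l]
    refine this.trans (mul_le_mul (le_abs_self _) ?_ (pow_nonneg h0 _) (abs_nonneg _))
    exact pow_le_pow_left₀ h0 (le_add_of_nonneg_left zero_le_one) _

theorem MemTilde.controlled (hO : IsOMinimal (lang F) M)
    (hcontrol : ∀ n, ∀ f ∈ F n, HasControlledDerivs F univ f) {f : (Fin n → M) → M}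
    (hf : MemTilde F f) : Controlled F f := by
  induction hf with
  | base hf => exact (hcontrol _ _ hf).controlled hO
  | poly p => exact Controlled.mvPolynomial p
  | add _ _ hf hg => exact hf.add hg
  | mul _ _ hf hg => exact hf.mul hg
  | smul q _ hf => exact (Controlled.const (q : M)).mul hf
  | deriv i _ hf => exact hf.pderiv i
  | rename σ _ hf => exact hf.rename σ

end Controlled

/-! ### Implicit differentiation -/

section Implicit

variable {M : Type u} [Field M] [LinearOrder M] [IsStrictOrderedRing M]
  [TopologicalSpace M] [OrderTopology M] {F : ∀ n : ℕ, Set ((Fin n → M) → M)} {n m : ℕ}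

/-- Definability on `U` is definability of `U` and of some total function that extends `f|_U`. -/
theorem DefinableOn.exists_defFun {U : Set (Fin n → M)} {f : (Fin n → M) → M} {A : Set M}
    (hf : DefinableOn F A U f) :
    DefPred F (· ∈ U) ∧ ∃ f', DefFun F f' ∧ EqOn f f' U := by
  classical
  have hg : DefPred F fun w : Option (Fin n) → M =>
      (fun i => w (some i)) ∈ U ∧ f (fun i => w (some i)) = w none := by
    have := Set.Definable.preimage_comp
      (fun i : Fin (n + 1) => (Fin.lastCases none some i : Option (Fin n)))
      (Set.Definable.mono hf (subset_univ A))
    unfold DefPred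
    convert this using 1
    ext w
    simp [Fin.init_def]
  have hU : DefPred F (· ∈ U) := by
    have := DefPred.ex (p := fun x y => x ∈ U ∧ f x = y) hg
    simpa using this
  refine ⟨hU, fun x => if x ∈ U then f x else 0, DefFun.of_graph ?_, fun x hx => by simp [hx]⟩
  have hU' : DefPred F fun w : Option (Fin n) → M => (fun i => w (some i)) ∈ U :=
    hU.subst fun i => DefFun.var (some i)
  convert hg.or (hU'.not.and ((DefFun.const 0).eq (DefFun.var none))) using 2 with w
  by_cases h : (fun i => w (some i)) ∈ U <;> simp [h]

theorem DefFun.definableOn {U : Set (Fin n → M)} {f f' : (Fin n → M) → M}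
    (hU : DefPred F (· ∈ U)) (hf' : DefFun F f') (h : EqOn f f' U) : DefinableOn F univ U f := by
  have h1 : DefPred F fun v : Fin (n + 1) → M => (fun i : Fin n => v i.castSucc) ∈ U :=
    hU.subst fun i => DefFun.var _
  have h2 : DefPred F fun v : Fin (n + 1) → M =>
      f' (fun i : Fin n => v i.castSucc) = v (Fin.last n) :=
    (hf'.comp fun i => DefFun.var _).eq (DefFun.var _)
  have h3 : {v : Fin (n + 1) → M | Fin.init v ∈ U ∧ f (Fin.init v) = v (Fin.last n)} =
      {v | (fun i : Fin n => v i.castSucc) ∈ U ∧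
        f' (fun i : Fin n => v i.castSucc) = v (Fin.last n)} := by
    ext v
    exact and_congr_right fun hv => by rw [h hv]; rfl
  unfold DefinableOn
  rw [h3]
  exact h1.and h2

theorem append_update_right (x : Fin n → M) (y : Fin m → M) (k : Fin m) (t : M) :
    Fin.append x (Function.update y k t) = Function.update (Fin.append x y) (Fin.natAdd n k) t := by
  ext j
  refine Fin.addCases (fun j => ?_) (fun j => ?_) j
  · have : Fin.castAdd m j ≠ Fin.natAdd n k := fun h => by
      have := congrArg Fin.val h
      simp at this
      omega
    simp [this]
  · by_cases h : j = k
    · subst h; simp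
    · have : Fin.natAdd n j ≠ Fin.natAdd n k := fun h' => h (Fin.natAdd_injective _ _ h')
      simp [h, this]

/-- The partial Jacobian matrix `∂g/∂y` of `g(x, y)`. -/
noncomputable def partialJacobian (g : Fin m → (Fin (n + m) → M) → M) (z : Fin (n + m) → M) :
    Matrix (Fin m) (Fin m) M :=
  Matrix.of fun j k => pderiv (Fin.natAdd n k) (g j) z

/-- The numerators of Cramer's rule for `∂y/∂xᵢ`: by implicit differentiation of `g(x, y) = 0`,
`∂yₖ/∂xᵢ` is `cramerNumerator g i k` divided by the determinant of `∂g/∂y`. -/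
noncomputable def cramerNumerator (g : Fin m → (Fin (n + m) → M) → M) (i : Fin n) (k : Fin m)
    (z : Fin (n + m) → M) : M :=
  -((partialJacobian g z).adjugate.mulVec fun j => pderiv (Fin.castAdd m i) (g j) z) k

theorem det_partialJacobian_ne_zero {g : Fin m → (Fin (n + m) → M) → M} (hg : ∀ j, IsC1 F (g j))
    {x : Fin n → M} {y : Fin m → M}
    (h : y ∈ Vreg fun j (y : Fin m → M) => g j (Fin.append x y)) :
    (partialJacobian g (Fin.append x y)).det ≠ 0 := by
  have hgrad : ∀ j, grad (fun y : Fin m → M => g j (Fin.append x y)) y =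
      partialJacobian g (Fin.append x y) j := by
    intro j
    ext k
    refine HasPDeriv.pderiv_eq ?_
    refine (hasPDeriv_pderiv ((hg j).hasPDeriv (Fin.natAdd n k) (Fin.append x y))).congr
      fun h => ?_
    simp only [append_update_right, Fin.append_right]
  have h2 := h.2
  simp only [hgrad] at h2
  have h3 := Matrix.linearIndependent_rows_iff_isUnit.1 h2
  exact ((Matrix.isUnit_iff_isUnit_det _).1 h3).ne_zero

variable {U : Set (Fin n → M)} {φ : Fin m → (Fin n → M) → M}

theorem continuousOn_append (hφ : ∀ k, ContinuousOn (φ k) U) :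
    ContinuousOn (fun x => Fin.append x fun k => φ k x) U := by
  refine continuousOn_pi.2 fun j => Fin.addCases (fun j => ?_) (fun j => ?_) j
  · simpa using (continuous_apply j).continuousOn
  · simpa using hφ j

theorem tendsto_append_update (hU : IsOpen U) (hφ : ∀ k, ContinuousOn (φ k) U) {x : Fin n → M}
    (hx : x ∈ U) (i : Fin n) :
    Tendsto (fun h : M => Fin.append (Function.update x i (x i + h))
      fun k => φ k (Function.update x i (x i + h))) (𝓝[≠] 0) (𝓝 (Fin.append x fun k => φ k x)) := by
  have ht : Tendsto (fun h : M => Function.update x i (x i + h)) (𝓝 0) (𝓝 x) := by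
    have hc : Continuous fun h : M => Function.update x i (x i + h) :=
      continuous_const.update i (continuous_const.add continuous_id)
    simpa using hc.tendsto 0
  exact (((continuousOn_append hφ).continuousAt (hU.mem_nhds hx)).tendsto.comp ht).mono_left
    nhdsWithin_le_nhds

theorem tendsto_neg_adjugate_mulVec {ι : Type*} {l : Filter ι} {B : ι → Matrix (Fin m) (Fin m) M}
    {a : ι → Fin m → M} {B₀ : Matrix (Fin m) (Fin m) M} {a₀ : Fin m → M}
    (hB : Tendsto B l (𝓝 B₀)) (ha : Tendsto a l (𝓝 a₀)) (k : Fin m) :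
    Tendsto (fun t => -((B t).adjugate.mulVec (a t)) k) l (𝓝 (-(B₀.adjugate.mulVec a₀) k)) := by
  have hcont : Continuous fun p : Matrix (Fin m) (Fin m) M × (Fin m → M) =>
      -(p.1.adjugate.mulVec p.2) k :=
    ((continuous_apply k).comp
      (continuous_fst.matrix_adjugate.matrix_mulVec continuous_snd)).neg
  have h1 : Tendsto (fun t => (B t, a t)) l (𝓝 (B₀, a₀)) := hB.prodMk_nhds ha
  have h2 := (hcont.tendsto (B₀, a₀)).comp h1
  exact h2

/-- Implicit differentiation. Existence and continuity of `φ` are given, so that no inverse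
function theorem is needed: the mean value theorem turns `g(x, φ(x)) = 0` into a linear system for
the difference quotients of `φ`, whose coefficients converge to the partial derivatives of `g`. -/
theorem hasPDeriv_implicit (hO : IsOMinimal (lang F) M) {g : Fin m → (Fin (n + m) → M) → M}
    (hg : ∀ j, IsC1 F (g j)) (hU : IsOpen U) (hφ : ∀ k, ContinuousOn (φ k) U)
    (hzero : ∀ x ∈ U, ∀ j, g j (Fin.append x fun k => φ k x) = 0) {x : Fin n → M} (hx : x ∈ U)
    (hdet : (partialJacobian g (Fin.append x fun k => φ k x)).det ≠ 0) (i : Fin n) (k : Fin m) :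
    HasPDeriv i (φ k) x (cramerNumerator g i k (Fin.append x fun k => φ k x) /
      (partialJacobian g (Fin.append x fun k => φ k x)).det) := by
  set z := Fin.append x fun k => φ k x with hz
  have hγ := tendsto_append_update hU hφ hx i
  rw [← hz] at hγ
  set γ : M → Fin (n + m) → M := fun h => Fin.append (Function.update x i (x i + h))
      fun k => φ k (Function.update x i (x i + h)) with hγdef
  choose q hq hinc using fun j => (hg j).exists_increment_eq hO z
  let B : M → Matrix (Fin m) (Fin m) M := fun h => Matrix.of fun j k => q j (γ h) (Fin.natAdd n k)
  let a : M → Fin m → M := fun h j => q j (γ h) (Fin.castAdd m i)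
  have hB : Tendsto B (𝓝[≠] 0) (𝓝 (partialJacobian g z)) :=
    tendsto_pi_nhds.2 fun j => tendsto_pi_nhds.2 fun k => (hq j _).comp hγ
  have ha : Tendsto a (𝓝[≠] 0) (𝓝 fun j => pderiv (Fin.castAdd m i) (g j) z) :=
    tendsto_pi_nhds.2 fun j => (hq j _).comp hγ
  have hdetc : Tendsto (fun h => (B h).det) (𝓝[≠] 0) (𝓝 (partialJacobian g z).det) :=
    ((continuous_id.matrix_det).tendsto (partialJacobian g z)).comp hB
  have hnum : Tendsto (fun h => -((B h).adjugate.mulVec (a h)) k) (𝓝[≠] 0)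
      (𝓝 (cramerNumerator g i k z)) :=
    tendsto_neg_adjugate_mulVec hB ha k
  have hlim := hnum.div hdetc hdet
  refine hlim.congr' ?_
  have hmem : ∀ᶠ h in 𝓝[≠] (0 : M), Function.update x i (x i + h) ∈ U := by
    have hc : Continuous fun h : M => Function.update x i (x i + h) :=
      continuous_const.update i (continuous_const.add continuous_id)
    have ht : Tendsto (fun h : M => Function.update x i (x i + h)) (𝓝 0) (𝓝 x) := by
      simpa using hc.tendsto 0
    exact nhdsWithin_le_nhds (ht (hU.mem_nhds hx))
  filter_upwards [hmem, hdetc.eventually_ne hdet, self_mem_nhdsWithin] with h hhU hhd hh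
  have hh : h ≠ 0 := hh
  let v : Fin m → M := fun k => (φ k (Function.update x i (x i + h)) - φ k x) / h
  have hsys : (B h).mulVec v = -a h := by
    ext j
    have e := hinc j (γ h)
    rw [hγdef, hzero _ hhU j, hz, hzero x hx j, Fin.sum_univ_add,
      Finset.sum_eq_single i (by intro b _ hb; simp [hb]) (by simp)] at e
    simp only [Fin.append_left, Fin.append_right, Function.update_self, add_sub_cancel_left,
      sub_zero] at e
    have e2 : (B h).mulVec v j = (∑ k, q j (γ h) (Fin.natAdd n k) *
        (φ k (Function.update x i (x i + h)) - φ k x)) / h := by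
      simp only [Matrix.mulVec, dotProduct, Finset.sum_div, B, v, Matrix.of_apply, mul_div_assoc]
    rw [e2, div_eq_iff hh]
    simp only [Pi.neg_apply, a]
    linear_combination -e
  have hv : (B h).det * v k = -((B h).adjugate.mulVec (a h)) k := by
    have := congrArg (fun u => (B h).adjugate.mulVec u k) hsys
    simp only [Matrix.mulVec_mulVec, Matrix.adjugate_mul, Matrix.mulVec_neg, Matrix.smul_mulVec,
      Matrix.one_mulVec, Pi.neg_apply, Pi.smul_apply, smul_eq_mul] at this
    exact this
  simp only [Pi.div_apply]
  rw [← hv, mul_div_cancel_left₀ _ hhd]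

end Implicit

/-! ### Fractions in an implicitly defined map -/

section Fractions

variable {M : Type u} [Field M] [LinearOrder M] [IsStrictOrderedRing M]
  [TopologicalSpace M] [OrderTopology M] {F : ∀ n : ℕ, Set ((Fin n → M) → M)} {n m : ℕ}

theorem HasPDeriv.inv {i : Fin n} {f : (Fin n → M) → M} {x : Fin n → M} {c : M}
    (hf : HasPDeriv i f x c) (h0 : f x ≠ 0) :
    HasPDeriv i (fun y => (f y)⁻¹) x (-c * (f x)⁻¹ ^ 2) := by
  have h1 : Tendsto (fun h => -((f (Function.update x i (x i + h)) - f x) / h) *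
      ((f (Function.update x i (x i + h)))⁻¹ * (f x)⁻¹)) (𝓝[≠] 0)
      (𝓝 (-c * ((f x)⁻¹ * (f x)⁻¹))) :=
    (Tendsto.neg hf).mul ((hf.tendsto.inv₀ h0).mul_const _)
  rw [← sq] at h1
  refine h1.congr' ?_
  filter_upwards [hf.tendsto.eventually_ne h0, self_mem_nhdsWithin] with h hne hh
  have hh : h ≠ 0 := hh
  field_simp
  ring

section RingMembership

variable {A : Subring ((Fin n → M) → M)}

theorem det_mem {B : (Fin n → M) → Matrix (Fin m) (Fin m) M}
    (hB : ∀ j k, (fun z => B z j k) ∈ A) : (fun z => (B z).det) ∈ A := by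
  have : (fun z => (B z).det) = ∑ σ : Equiv.Perm (Fin m),
      Equiv.Perm.sign σ • ∏ j, fun z => B z (σ j) j := by
    ext z
    simp [Matrix.det_apply, Finset.sum_apply, Finset.prod_apply, Units.smul_def]
  rw [this]
  exact A.sum_mem fun σ _ => A.zsmul_mem (A.prod_mem fun j _ => hB _ _) _

theorem adjugate_mem {B : (Fin n → M) → Matrix (Fin m) (Fin m) M}
    (hB : ∀ j k, (fun z => B z j k) ∈ A) (j k : Fin m) :
    (fun z => (B z).adjugate j k) ∈ A := by
  simp only [Matrix.adjugate_apply]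
  refine det_mem fun a b => ?_
  by_cases h : a = k
  · subst h
    simp only [Matrix.updateRow_self]
    by_cases hb : b = j
    · subst hb
      simp only [Pi.single_eq_same]
      exact A.one_mem
    · simp only [Pi.single_eq_of_ne hb]
      exact A.zero_mem
  · simpa only [Matrix.updateRow_ne h] using hB a b

end RingMembership

variable {ω : (Fin (n + m) → M) → M} {A : Subring ((Fin (n + m) → M) → M)}
  {g : Fin m → (Fin (n + m) → M) → M} {U : Set (Fin n → M)} {φ : Fin m → (Fin n → M) → M}

theorem det_partialJacobian_mem (hA : IsDerivClosed F ω (A : Set ((Fin (n + m) → M) → M)))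
    (hg : ∀ j, g j ∈ A) : (fun z => (partialJacobian g z).det) ∈ A :=
  det_mem fun j k => hA.pderiv_mem _ (hg j) (Fin.natAdd n k)

theorem cramerNumerator_mem (hA : IsDerivClosed F ω (A : Set ((Fin (n + m) → M) → M)))
    (hg : ∀ j, g j ∈ A) (i : Fin n) (k : Fin m) : cramerNumerator g i k ∈ A := by
  have : cramerNumerator g i k = -∑ j, (fun z => (partialJacobian g z).adjugate k j) *
      pderiv (Fin.castAdd m i) (g j) := by
    ext z
    simp [cramerNumerator, Matrix.mulVec, dotProduct, Finset.sum_apply]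
  rw [this]
  exact A.neg_mem (A.sum_mem fun j _ => A.mul_mem
    (adjugate_mem (fun j k => hA.pderiv_mem _ (hg j) (Fin.natAdd n k)) k j)
    (hA.pderiv_mem _ (hg j) _))

/-- The data of an implicitly defined map `φ` on `U`, together with a controlled ring `A` that
contains the functions `g` in the system and the coordinates. -/
structure IsRegularSolution (F : ∀ n : ℕ, Set ((Fin n → M) → M)) (ω : (Fin (n + m) → M) → M)
    (A : Subring ((Fin (n + m) → M) → M)) (g : Fin m → (Fin (n + m) → M) → M)
    (U : Set (Fin n → M)) (φ : Fin m → (Fin n → M) → M) : Prop where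
  derivClosed : IsDerivClosed F ω (A : Set ((Fin (n + m) → M) → M))
  mem : ∀ j, g j ∈ A
  coord_mem : ∀ k : Fin (n + m), (fun z => z k) ∈ A
  isOpen : IsOpen U
  continuousOn : ∀ k, ContinuousOn (φ k) U
  regular : ∀ x ∈ U, (fun j => φ j x) ∈ Vreg fun j (y : Fin m → M) => g j (Fin.append x y)

theorem IsRegularSolution.det_ne_zero (h : IsRegularSolution F ω A g U φ) {x : Fin n → M}
    (hx : x ∈ U) : (partialJacobian g (Fin.append x fun k => φ k x)).det ≠ 0 :=
  det_partialJacobian_ne_zero (fun j => h.derivClosed.isC1 (h.mem j)) (h.regular x hx)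

/-- For `P` in the ring, each partial derivative of `x ↦ P(x, φ(x))` is of the form
`Q(x, φ(x)) / det(∂g/∂y)(x, φ(x))` with `Q` in the ring. -/
theorem IsRegularSolution.exists_hasPDeriv (hO : IsOMinimal (lang F) M)
    (h : IsRegularSolution F ω A g U φ) {P : (Fin (n + m) → M) → M} (hP : P ∈ A) (i : Fin n) :
    ∃ Q ∈ A, ∀ x ∈ U, HasPDeriv i (fun x => P (Fin.append x fun k => φ k x)) x
      (Q (Fin.append x fun k => φ k x) *
        (partialJacobian g (Fin.append x fun k => φ k x)).det⁻¹) := by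
  -- the chain rule, with the terms `∂P/∂xᵢ` and `∂P/∂yₖ * ∂φₖ/∂xᵢ` put over the denominator `D`
  refine ⟨pderiv (Fin.castAdd m i) P * (fun z => (partialJacobian g z).det) +
    ∑ k, pderiv (Fin.natAdd n k) P * cramerNumerator g i k, ?_, fun x hx => ?_⟩
  · exact A.add_mem (A.mul_mem (h.derivClosed.pderiv_mem P hP _)
      (det_partialJacobian_mem h.derivClosed h.mem)) (A.sum_mem fun k _ =>
        A.mul_mem (h.derivClosed.pderiv_mem P hP _) (cramerNumerator_mem h.derivClosed h.mem i k))
  have hD := h.det_ne_zero hx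
  have key := (h.derivClosed.isC1 hP).tendsto_comp hO
    (tendsto_append_update h.isOpen h.continuousOn hx i)
    (d := Fin.append (fun j => if j = i then 1 else 0) fun k =>
      cramerNumerator g i k (Fin.append x fun k => φ k x) /
        (partialJacobian g (Fin.append x fun k => φ k x)).det) (fun l => by
      refine Fin.addCases (fun j => ?_) (fun k => ?_) l
      · simpa [HasPDeriv] using HasPDeriv.coord (i := i) (x := x) j
      · simpa [HasPDeriv] using hasPDeriv_implicit hO (fun j => h.derivClosed.isC1 (h.mem j))
          h.isOpen h.continuousOn (fun x hx => (h.regular x hx).1) hx hD i k)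
  unfold HasPDeriv
  convert key using 2
  rw [Fin.sum_univ_add]
  simp only [Fin.append_left, Fin.append_right, mul_ite, mul_one, mul_zero, Finset.sum_ite_eq',
    Finset.mem_univ, if_true, Pi.add_apply, Pi.mul_apply, Finset.sum_apply, add_mul,
    Finset.sum_mul]
  rw [mul_assoc, mul_inv_cancel₀ hD, mul_one]
  congr 1
  exact Finset.sum_congr rfl fun k _ => by rw [mul_assoc, div_eq_mul_inv]

/-- On `U`, the function `f` is a fraction `P(x, φ(x)) / det(∂g/∂y)(x, φ(x)) ^ e` with `P` in the
ring `A`. -/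
def IsFraction (A : Subring ((Fin (n + m) → M) → M)) (g : Fin m → (Fin (n + m) → M) → M)
    (U : Set (Fin n → M)) (φ : Fin m → (Fin n → M) → M) (f : (Fin n → M) → M) : Prop :=
  ∃ P ∈ A, ∃ e : ℕ, EqOn f (fun x => P (Fin.append x fun k => φ k x) *
    (partialJacobian g (Fin.append x fun k => φ k x)).det⁻¹ ^ e) U

theorem IsRegularSolution.isFraction_component (h : IsRegularSolution F ω A g U φ)
    {f : (Fin n → M) → M} {k : Fin m} (hf : EqOn f (φ k) U) : IsFraction A g U φ f :=
  ⟨_, h.coord_mem (Fin.natAdd n k), 0, fun x hx => by simp [hf hx]⟩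

/-- The fractions are closed under partial differentiation. -/
theorem IsRegularSolution.isFraction_pderiv (hO : IsOMinimal (lang F) M)
    (h : IsRegularSolution F ω A g U φ) {f : (Fin n → M) → M} (hf : IsFraction A g U φ f)
    (i : Fin n) : (∀ x ∈ U, ∃ d, HasPDeriv i f x d) ∧ IsFraction A g U φ (pderiv i f) := by
  obtain ⟨P, hP, e, he⟩ := hf
  have hDm := det_partialJacobian_mem h.derivClosed h.mem
  obtain ⟨Q, hQ, hPd⟩ := h.exists_hasPDeriv hO hP i
  obtain ⟨Δ, hΔ, hDd⟩ := h.exists_hasPDeriv hO hDm i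
  -- raising the exponent by two in each derivative avoids the truncated exponent `e - 1`
  have hpow : ∀ e : ℕ, ∃ T ∈ A, ∀ x ∈ U, HasPDeriv i
      (fun x => (partialJacobian g (Fin.append x fun k => φ k x)).det⁻¹ ^ e) x
      (T (Fin.append x fun k => φ k x) *
        (partialJacobian g (Fin.append x fun k => φ k x)).det⁻¹ ^ (e + 2)) := by
    intro e
    induction e with
    | zero => exact ⟨0, A.zero_mem, fun x _ => by simpa using HasPDeriv.const 1⟩
    | succ e ih =>
      obtain ⟨T, hT, hTd⟩ := ih
      refine ⟨T - Δ, A.sub_mem hT hΔ, fun x hx => ?_⟩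
      simp only [pow_succ _ e]
      convert (hTd x hx).mul ((hDd x hx).inv (h.det_ne_zero hx)) using 1
      simp only [Pi.sub_apply]
      ring
  obtain ⟨T, hT, hTd⟩ := hpow e
  have hd : ∀ x ∈ U, HasPDeriv i f x
      ((Q * (fun z => (partialJacobian g z).det) + P * T) (Fin.append x fun k => φ k x) *
        (partialJacobian g (Fin.append x fun k => φ k x)).det⁻¹ ^ (e + 2)) := by
    intro x hx
    refine HasPDeriv.congr_of_isOpen h.isOpen (fun y hy => (he hy).symm) hx ?_
    convert (hPd x hx).mul (hTd x hx) using 1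
    have hD := mul_inv_cancel₀ (h.det_ne_zero hx)
    simp only [Pi.add_apply, Pi.mul_apply]
    linear_combination Q (Fin.append x fun k => φ k x) *
      (partialJacobian g (Fin.append x fun k => φ k x)).det⁻¹ ^ (e + 1) * hD
  exact ⟨fun x hx => ⟨_, hd x hx⟩, _, A.add_mem (A.mul_mem hQ hDm) (A.mul_mem hP hT), e + 2,
    fun x hx => (hd x hx).pderiv_eq⟩

theorem IsRegularSolution.isFraction_iterPDeriv (hO : IsOMinimal (lang F) M)
    (h : IsRegularSolution F ω A g U φ) {f : (Fin n → M) → M} (hf : IsFraction A g U φ f)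
    (l : List (Fin n)) : IsFraction A g U φ (iterPDeriv l f) := by
  induction l with
  | nil => exact hf
  | cons i l ih => exact (h.isFraction_pderiv hO ih i).2

theorem IsRegularSolution.continuousOn_det (h : IsRegularSolution F ω A g U φ) :
    ContinuousOn (fun x => (partialJacobian g (Fin.append x fun k => φ k x)).det⁻¹) U :=
  ((h.derivClosed.continuous _ (det_partialJacobian_mem h.derivClosed h.mem)).comp_continuousOn
    (continuousOn_append h.continuousOn)).inv₀ fun _ hx => h.det_ne_zero hx

theorem IsRegularSolution.isSmoothOn (hO : IsOMinimal (lang F) M)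
    (h : IsRegularSolution F ω A g U φ) {f : (Fin n → M) → M} (hf : IsFraction A g U φ f) :
    IsSmoothOn U f := by
  intro l
  have hl := h.isFraction_iterPDeriv hO hf l
  refine ⟨?_, fun x hx i => (h.isFraction_pderiv hO hl i).1 x hx⟩
  obtain ⟨P, hP, e, he⟩ := hl
  exact (((h.derivClosed.continuous P hP).comp_continuousOn
    (continuousOn_append h.continuousOn)).mul (h.continuousOn_det.pow e)).congr he

/-- All fractions are controlled by `ω(x, φ(x)) + |det(∂g/∂y)(x, φ(x))|⁻¹`. -/
theorem IsRegularSolution.boundedByPow (h : IsRegularSolution F ω A g U φ) (hω : ∀ z, 1 ≤ ω z)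
    {f : (Fin n → M) → M} (hf : IsFraction A g U φ f) :
    BoundedByPow U (fun x => ω (Fin.append x fun k => φ k x) +
      |(partialJacobian g (Fin.append x fun k => φ k x)).det⁻¹|) f := by
  obtain ⟨P, hP, e, he⟩ := hf
  have hω0 : ∀ z, 0 ≤ ω z := fun z => zero_le_one.trans (hω z)
  have h1 : BoundedByPow U (fun x => ω (Fin.append x fun k => φ k x) +
      |(partialJacobian g (Fin.append x fun k => φ k x)).det⁻¹|)
      fun x => P (Fin.append x fun k => φ k x) :=
    ((h.derivClosed.bounded P hP).comp (V := U) (t := fun x => Fin.append x fun k => φ k x)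
      fun _ _ => mem_univ _).mono (fun x _ => hω0 _)
        fun x _ => le_add_of_nonneg_right (abs_nonneg _)
  have h2 : BoundedByPow U (fun x => ω (Fin.append x fun k => φ k x) +
      |(partialJacobian g (Fin.append x fun k => φ k x)).det⁻¹|)
      fun x => (partialJacobian g (Fin.append x fun k => φ k x)).det⁻¹ := by
    refine (BoundedByPow.self fun x _ => (hω _).trans
      (le_add_of_nonneg_right (abs_nonneg _))).of_abs_le fun x _ => ?_
    exact (le_add_of_nonneg_left (hω0 _)).trans (le_abs_self _)
  exact (h1.mul (h2.pow e)).of_abs_le fun x hx => by rw [he hx]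

/-- A bound for each single derivative gives bounds that only depend on the order, since there are
finitely many multi-indices of each order. -/
theorem exists_uniform_bound {X : Type*} {U : Set X} {ω : X → M} (hω : ∀ x ∈ U, 1 ≤ ω x)
    {D : (Fin n → ℕ) → X → M} (hD : ∀ α, BoundedByPow U ω (D α)) :
    ∃ (C : ℕ → M) (E : ℕ → ℕ), ∀ α, ∀ x ∈ U, |D α x| ≤ C (∑ i, α i) * ω x ^ E (∑ i, α i) := by
  choose C E hC hb using hD
  refine ⟨fun k => ∑ α ∈ Finset.piAntidiag Finset.univ k, C α,
    fun k => ∑ α ∈ Finset.piAntidiag Finset.univ k, E α, fun α x hx => (hb α x hx).trans ?_⟩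
  have hα : α ∈ Finset.piAntidiag (Finset.univ : Finset (Fin n)) (∑ i, α i) := by simp
  exact mul_le_mul (Finset.single_le_sum (fun β _ => hC β) hα)
    (pow_le_pow_right₀ (hω x hx) (Finset.single_le_sum (fun β _ => Nat.zero_le _) hα))
    (pow_nonneg (zero_le_one.trans (hω x hx)) _) (Finset.sum_nonneg fun β _ => hC β)

end Fractions

end ControlledDeriv

theorem mainTheorem7 {M : Type u} [Field M] [LinearOrder M] [IsStrictOrderedRing M]
    [IsRealClosed M] [TopologicalSpace M] [OrderTopology M]
    (F : ∀ n : ℕ, Set ((Fin n → M) → M)) (hF : ControlledDeriv.IsLPB F)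
    (hcontrol : ∀ n, ∀ f ∈ F n, ControlledDeriv.HasControlledDerivs F univ f)
    {n : ℕ} (U : Set (Fin n → M)) (f : (Fin n → M) → M)
    (hf : ControlledDeriv.IsImplicitlyDefined F U f) :
    ControlledDeriv.HasControlledDerivs F U f := by
  open ControlledDeriv in
  obtain ⟨hU, hfd, m, -, g, φ, hg, hφd, hφc, ⟨k, hfk⟩, hreg⟩ := hf
  have hO := hF.oMinimal
  -- the coordinates are adjoined so that `φ k` itself is a fraction
  have hctl : ∀ s, Controlled F (Sum.elim g (fun (k : Fin (n + m)) z => z k) s) := by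
    rintro (j | k)
    · exact (hg j).controlled hO hcontrol
    · exact Controlled.coord k
  obtain ⟨ω, A, hω, hω1, hA, hmem⟩ := exists_subring_of_controlled hctl
  have hsol : IsRegularSolution F ω A g U φ :=
    ⟨hA, fun j => hmem (Sum.inl j), fun k => hmem (Sum.inr k), hU, hφc, hreg⟩
  have hfrac := hsol.isFraction_component hfk
  obtain ⟨hUd, f', hf'd, hf'⟩ := hfd.exists_defFun
  -- total definable extensions of the `φ k`, by which the control function is seen to be definable
  choose _ φ' hφ'd hφ' using fun k => (hφd k).exists_defFun
  have happ : ∀ x ∈ U, (Fin.append x fun k => φ k x) = Fin.append x fun k => φ' k x :=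
    fun x hx => congrArg _ (funext fun k => hφ' k hx)
  have happd : ∀ l, DefFun F fun x => (Fin.append x fun k => φ' k x : Fin (n + m) → M) l := by
    intro l
    refine Fin.addCases (fun j => ?_) (fun k => ?_) l
    · simpa using DefFun.var j
    · simpa using hφ'd k
  have hDm := det_partialJacobian_mem hA hsol.mem
  have hρ1 : ∀ x ∈ U, 1 ≤ ω (Fin.append x fun k => φ k x) +
      |(partialJacobian g (Fin.append x fun k => φ k x)).det⁻¹| := fun x _ =>
    (hω1 _).trans (le_add_of_nonneg_right (abs_nonneg _))
  obtain ⟨C, E, hCE⟩ := exists_uniform_bound hρ1 fun α : Fin n → ℕ =>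
    hsol.boundedByPow hω1 (hsol.isFraction_iterPDeriv hO hfrac
      ((List.finRange n).flatMap fun i => List.replicate (α i) i))
  refine ⟨hU, hf'd.definableOn hUd hf', hsol.isSmoothOn hO hfrac, _, C, E, ?_, ?_,
    fun x hx => zero_le_one.trans (hρ1 x hx), hCE⟩
  · refine DefFun.definableOn hUd (f' := fun x => ω (Fin.append x fun k => φ' k x) +
      |(partialJacobian g (Fin.append x fun k => φ' k x)).det⁻¹|) ?_ fun x hx => ?_
    · exact (hω.1.comp happd).add ((hA.defFun _ hDm).comp happd).inv.abs
    · simp only [happ x hx]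
  · exact (hω.2.comp_continuousOn (continuousOn_append hφc)).add hsol.continuousOn_det.abs
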